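/- **Theorem (multipliers for box/staged constraints).** Let $L_i\in\mathbb R^{r_i\times n}$ $(0\le i\le N-1)$ with rows $L_{ij}$ satisfy $L_iL_k^T=0$ for $i\ne k$, let $W_{ij}>0$, and let $\mathcal U=\{u\in\mathbb R^n: L_{ij}u\le W_{ij}\ \forall i,j\}$ be compact. Let each constraint be hard ($\delta_{ij}=0$) or soft ($0<\delta_{ij}\le W_{ij}$), let $c_{ij}>0$ be weights, and let $$B(u)=\sum_{i,j}c_{ij}\Big(\beta_{ij}(W_{ij}-L_{ij}u)+\ln W_{ij}-\frac{L_{ij}u}{W_{ij}}\Big)$$ be the (possibly relaxed) recentered log-barrier on the open set $\mathbf U=\{u: L_{ij}u<W_{ij}\text{ for all hard }(i,j)\}$, where $\beta_{ij}(t)=-\ln t$ for $t>\delta_{ij}$ and, for soft constraints, $\beta_{ij}(t)=\frac12\big[\big(\frac{t-2\delta_{ij}}{\delta_{ij}}\big)^2-1\big]-\ln\delta_{ij}$ for $t\le\delta_{ij}$. (With $c_{ij}=1$ this is the gradient recentered barrier; with $\sum c_{ij}L_{ij}/W_{ij}=0$ the weight recentered one.) Let $\mu>0$, let $m\ge0$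 satisfy $\nabla^2B(u)\ge mI$ on $\mathbf U$, let $H=H^T\ge0$, and assume that $\tilde H=H+\mu mI$ is positive definite. Then for every $\theta\in\mathbb R^n$ the barrier-MPC problem $$\phi(\theta)=\arg\min_{u\in\mathbf U}\ \tfrac12u^THu-\theta^Tu+\mu B(u)$$ has exactly one solution. Let $\mathcal M_+$ be the class of real rational scalar transfer functions $M$ without poles on the unit circle such that $M(z)=H_s-\sum_{k\in\mathbb Z}h_kz^{-k}$ for $|z|=1$, with $h\in\ell_1(\mathbb Z)$, $h_k\ge0$ and $\|h\|_1\le H_s$. Let $M_{ZF_0},\dots,M_{ZF_{N-1}}\in\mathcal M_+$ (strictly proper or not). We say that $\phi$ admits the IQC with multiplier $\Pi$ if $\Pi$ is measurable, bounded and Hermitian on the unit circle and, for every $\theta\in\ell_2^n(\mathbb Z)$, $\phi(\theta)\in\ell_2^n(\mathbb Z)$ (where $\phi(\theta)_k=\phi(\theta_k)$) and $$\int_{-\pi}^{\pi}\begin{bmatrix}\hat\theta(e^{j\omega})\\ \widehat{\phi(\theta)}(e^{j\omega})\end{bmatrix}^*\Pi(e^{j\omega})\begin{bmatrix}\hat\theta(e^{j\omega})\\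 \widehat{\phi(\theta)}(e^{j\omega})\end{bmatrix}d\omega\ge0 .$$ 1. If the rows of $\bar L_i$ form an orthonormal basis of the row space of $L_i$, and $$\Pi_\psi(z)=\sum_{i=0}^{N-1}\begin{bmatrix}\bar L_i&0\\0&\bar L_i\end{bmatrix}^T\begin{bmatrix}0&M_{ZF_i}(z)^*I\\ M_{ZF_i}(z)I&-M_{ZF_i}(z)I-M_{ZF_i}(z)^*I\end{bmatrix}\begin{bmatrix}\bar L_i&0\\0&\bar L_i\end{bmatrix},$$ then $\phi$ admits the IQC with multiplier $$\Pi(z)=\begin{bmatrix}I&I-\tilde H\\0&I\end{bmatrix}^T\Pi_\psi(z)\begin{bmatrix}I&I-\tilde H\\0&I\end{bmatrix}.$$ 2. If moreover the constraints are box or staged, that is, the coordinates of $u$ are partitioned into blocks $0,\dots,N-1$ and the rows of $L_i$ involve only the coordinates of block $i$ (so $L=\mathrm{diag}(\tilde L_0,\dots,\tilde L_{N-1})$), then with $M_{ZF}=\mathrm{diag}(M_{ZF_0}I,\dots,M_{ZF_{N-1}}I)$, partitioned in the same way, $$\Pi(z)=\begin{bmatrix}0&M_{ZF}(z)^*\\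 M_{ZF}(z)&-M_{ZF}(z)\tilde H-\tilde HM_{ZF}(z)^*\end{bmatrix},$$ and $\phi$ admits the IQC with this multiplier. -/

import Mathlib

open scoped Matrix

noncomputable section

/-- Linear input constraints `L_i u ≤ W_i` (grouped in `N` families of rows) on `ℝⁿ`, with the
parameters of a recentered log-barrier for them. Row `(i, j)` is a hard constraint if `δ i j = 0`,
and a soft constraint with relaxation parameter `δ i j` if `δ i j > 0`. The number `c i j` is the
weight of the row. -/
structure BarrierConstraints (n N : ℕ) where
  r : Fin N → ℕ
  L : (i : Fin N) → Matrix (Fin (r i)) (Fin n) ℝ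
  W : (i : Fin N) → Fin (r i) → ℝ
  δ : (i : Fin N) → Fin (r i) → ℝ
  c : (i : Fin N) → Fin (r i) → ℝ
  W_pos : ∀ i j, 0 < W i j
  δ_nonneg : ∀ i j, 0 ≤ δ i j
  δ_le : ∀ i j, δ i j ≤ W i j
  c_pos : ∀ i j, 0 < c i j

/-- The negative logarithm, continued below `δ` (when `δ > 0`) by the quadratic polynomial that
makes it twice continuously differentiable. For `δ = 0` it is only used at `t > 0`. -/
def relaxedNegLog (δ t : ℝ) : ℝ :=
  if δ < t then -Real.log t else (1 / 2) * (((t - 2 * δ) / δ) ^ 2 - 1) - Real.log δ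

namespace BarrierConstraints

variable {n N : ℕ} (C : BarrierConstraints n N)

/-- The polyhedron `{u : L u ≤ W}`. -/
def feasible : Set (EuclideanSpace ℝ (Fin n)) :=
  {u | ∀ i j, (C.L i *ᵥ WithLp.ofLp u) j ≤ C.W i j}

/-- The open convex domain of the barrier: only the hard constraints restrict it. -/
def domain : Set (EuclideanSpace ℝ (Fin n)) :=
  {u | ∀ i j, C.δ i j = 0 → (C.L i *ᵥ WithLp.ofLp u) j < C.W i j}

/-- The (possibly relaxed) recentered log-barrier. With all weights `c = 1` it is the gradient
recentered barrier. With `c = 1 + w` and `∑ c_{ij} L_{ij} / W_{ij} = 0` the linear terms cancel and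
it is the weight recentered barrier. -/
def barrier (u : EuclideanSpace ℝ (Fin n)) : ℝ :=
  ∑ i, ∑ j, C.c i j *
    (relaxedNegLog (C.δ i j) (C.W i j - (C.L i *ᵥ WithLp.ofLp u) j) + Real.log (C.W i j)
      - (C.L i *ᵥ WithLp.ofLp u) j / C.W i j)

/-- `∇²B(u) ≥ m I` on the domain of the barrier `B`. -/
def HessianLowerBound (m : ℝ) : Prop :=
  ∀ u ∈ C.domain, ∀ v : EuclideanSpace ℝ (Fin n),
    m * ‖v‖ ^ 2 ≤ iteratedFDeriv ℝ 2 C.barrier u ![v, v]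

/-- The constraint rows decompose orthogonally: `L_i L_jᵀ = 0` for `i ≠ j`. -/
def OrthogonalRows : Prop :=
  ∀ i j, i ≠ j → C.L i * (C.L j)ᵀ = 0

/-- Box or staged constraints, `L = diag(L̃_0, …, L̃_{N-1})`: the input coordinate `k` belongs to
block `blk k`, and the rows of `L_i` involve only coordinates of block `i`. -/
def BlockDiagonal (blk : Fin n → Fin N) : Prop :=
  ∀ i j k, blk k ≠ i → C.L i j k = 0

/-- The barrier MPC objective `½ uᵀ H u - θᵀ u + μ B(u)`. -/
def objective (H : Matrix (Fin n) (Fin n) ℝ) (μ : ℝ) (θ u : EuclideanSpace ℝ (Fin n)) : ℝ :=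
  (1 / 2) * (WithLp.ofLp u ⬝ᵥ (H *ᵥ WithLp.ofLp u)) - WithLp.ofLp θ ⬝ᵥ WithLp.ofLp u
    + μ * C.barrier u

/-- `u` minimizes the barrier MPC objective over the domain of the barrier. -/
def IsMPCSolution (H : Matrix (Fin n) (Fin n) ℝ) (μ : ℝ) (θ u : EuclideanSpace ℝ (Fin n)) :
    Prop :=
  u ∈ C.domain ∧ IsMinOn (C.objective H μ θ) C.domain u

/-- The barrier MPC map `φ(θ) = argmin_u ½ uᵀ H u - θᵀ u + μ B(u)`. -/
def mpcMap (H : Matrix (Fin n) (Fin n) ℝ) (μ : ℝ) (θ : EuclideanSpace ℝ (Fin n)) :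
    EuclideanSpace ℝ (Fin n) :=
  Classical.epsilon (C.IsMPCSolution H μ θ)

/-- The rows of `Lb i` form an orthonormal basis of the span of the rows of `L_i`. -/
def IsOrthonormalRowBasis {ρ : Fin N → ℕ} (Lb : (i : Fin N) → Matrix (Fin (ρ i)) (Fin n) ℝ) :
    Prop :=
  ∀ i, Lb i * (Lb i)ᵀ = 1 ∧
    Submodule.span ℝ (Set.range fun a => Lb i a) = Submodule.span ℝ (Set.range fun j => C.L i j)

end BarrierConstraints

instance fact_two_pi_pos : Fact (0 < 2 * Real.pi) := ⟨Real.two_pi_pos⟩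

/-- The Fourier transform `x̂(e^{jω}) = ∑_k x_k e^{-jωk}` (the series converging in `L²`) of a real
square summable sequence, as a function of `ω`. -/
def dtft (x : ℤ → ℝ) (ω : ℝ) : ℂ :=
  open scoped Classical in
  if h : Memℓp (fun k : ℤ => ((x (-k) : ℝ) : ℂ)) 2 then
    ((fourierBasis (T := 2 * Real.pi)).repr.symm ⟨_, h⟩ : AddCircle (2 * Real.pi) → ℂ)
      (ω : AddCircle (2 * Real.pi))
  else 0

/-- The stacked vector `(ŵ(e^{jω}), v̂(e^{jω}))`. -/
def freqStack {n : ℕ} (w v : ℤ → EuclideanSpace ℝ (Fin n)) (ω : ℝ) : Fin n ⊕ Fin n → ℂ :=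
  Sum.elim (fun a => dtft (fun k => w k a) ω) (fun a => dtft (fun k => v k a) ω)

/-- The quadratic form `(ŵ, v̂)^* P(e^{jω}) (ŵ, v̂)`. -/
def iqcIntegrand {n : ℕ} (P : ℂ → Matrix (Fin n ⊕ Fin n) (Fin n ⊕ Fin n) ℂ)
    (w v : ℤ → EuclideanSpace ℝ (Fin n)) (ω : ℝ) : ℂ :=
  star (freqStack w v ω) ⬝ᵥ (P (Complex.exp (ω * Complex.I)) *ᵥ freqStack w v ω)

/-- The signals `w`, `v` satisfy the integral quadratic constraint defined by `P`. -/
def SatisfiesIQC {n : ℕ} (P : ℂ → Matrix (Fin n ⊕ Fin n) (Fin n ⊕ Fin n) ℂ)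
    (w v : ℤ → EuclideanSpace ℝ (Fin n)) : Prop :=
  IntervalIntegrable (iqcIntegrand P w v) MeasureTheory.volume (-Real.pi) Real.pi ∧
    0 ≤ (∫ ω in (-Real.pi)..Real.pi, iqcIntegrand P w v ω).re

/-- `P` is measurable, bounded and Hermitian on the unit circle. -/
structure IsIQCMultiplier {n : ℕ} (P : ℂ → Matrix (Fin n ⊕ Fin n) (Fin n ⊕ Fin n) ℂ) : Prop where
  measurable : ∀ a b, Measurable fun ω : ℝ => P (Complex.exp (ω * Complex.I)) a b
  bounded : ∃ K : ℝ, ∀ z : ℂ, ‖z‖ = 1 → ∀ a b, ‖P z a b‖ ≤ K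
  hermitian : ∀ z : ℂ, ‖z‖ = 1 → (P z).IsHermitian

/-- The memoryless map `φ` takes `ℓ₂` into `ℓ₂`, and every pair `(θ, φ(θ))` with `θ ∈ ℓ₂` satisfies
the integral quadratic constraint defined by the multiplier `P`. -/
def AdmitsIQC {n : ℕ} (φ : EuclideanSpace ℝ (Fin n) → EuclideanSpace ℝ (Fin n))
    (P : ℂ → Matrix (Fin n ⊕ Fin n) (Fin n ⊕ Fin n) ℂ) : Prop :=
  IsIQCMultiplier P ∧
    ∀ θ : ℤ → EuclideanSpace ℝ (Fin n), Memℓp θ 2 →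
      Memℓp (fun k => φ (θ k)) 2 ∧ SatisfiesIQC P θ (fun k => φ (θ k))

/-- The value at `z` of a real rational transfer function. -/
def transferEval (M : RatFunc ℝ) (z : ℂ) : ℂ :=
  M.eval (algebraMap ℝ ℂ) z

/-- The single-input single-output class `𝓜₊` of rational Zames–Falb multipliers: `M` has no pole on
the unit circle, and there `M(z) = H_s - ∑_k h_k z^{-k}` with `h ∈ ℓ₁(ℤ)`, `h ≥ 0` and
`‖h‖₁ ≤ H_s`. -/
def IsZamesFalbPlus (M : RatFunc ℝ) : Prop :=
  (∀ z : ℂ, ‖z‖ = 1 → M.denom.eval₂ (algebraMap ℝ ℂ) z ≠ 0) ∧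
    ∃ (Hs : ℝ) (h : ℤ → ℝ), Summable h ∧ (∀ k, 0 ≤ h k) ∧ ∑' k, |h k| ≤ Hs ∧
      ∀ z : ℂ, ‖z‖ = 1 → transferEval M z = (Hs : ℂ) - ∑' k : ℤ, (h k : ℂ) * z ^ (-k)

/-- `H̃ = H + μ m I`. -/
def slopeMatrix {n : ℕ} (H : Matrix (Fin n) (Fin n) ℝ) (μ m : ℝ) : Matrix (Fin n) (Fin n) ℝ :=
  H + (μ * m) • (1 : Matrix (Fin n) (Fin n) ℝ)

/-- A real matrix regarded as a complex one. -/
def toComplex {ι κ : Type*} (A : Matrix ι κ ℝ) : Matrix ι κ ℂ :=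
  A.map (algebraMap ℝ ℂ)

/-- The multiplier `[0, M^*; M, -M - M^*]` with `M = M(z) I`. -/
def unitSlopeMultiplier (p : ℕ) (M : RatFunc ℝ) (z : ℂ) : Matrix (Fin p ⊕ Fin p) (Fin p ⊕ Fin p) ℂ :=
  Matrix.fromBlocks 0 (star (transferEval M z) • 1) (transferEval M z • 1)
    (-(transferEval M z • 1) - star (transferEval M z) • 1)

/-- The multiplier `Π_ψ(z) = ∑_i diag(L̄_i, L̄_i)ᵀ Π_{ν_i}(z) diag(L̄_i, L̄_i)`. -/
def parallelMultiplier {n N : ℕ} {ρ : Fin N → ℕ} (Lb : (i : Fin N) → Matrix (Fin (ρ i)) (Fin n) ℝ)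
    (M : Fin N → RatFunc ℝ) (z : ℂ) : Matrix (Fin n ⊕ Fin n) (Fin n ⊕ Fin n) ℂ :=
  ∑ i, (Matrix.fromBlocks (toComplex (Lb i)) 0 0 (toComplex (Lb i)))ᵀ
    * unitSlopeMultiplier (ρ i) (M i) z
    * Matrix.fromBlocks (toComplex (Lb i)) 0 0 (toComplex (Lb i))

/-- The loop transformation `[I, I - H̃; 0, I]`. -/
def loopTransform {n : ℕ} (Ht : Matrix (Fin n) (Fin n) ℝ) : Matrix (Fin n ⊕ Fin n) (Fin n ⊕ Fin n) ℂ :=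
  Matrix.fromBlocks 1 (1 - toComplex Ht) 0 1

/-- `M_ZF(z) = diag(M_0(z) I, …, M_{N-1}(z) I)`, the identity blocks having the sizes of the blocks of
input coordinates. -/
def blockMultiplier {n N : ℕ} (blk : Fin n → Fin N) (M : Fin N → RatFunc ℝ) (z : ℂ) :
    Matrix (Fin n) (Fin n) ℂ :=
  Matrix.diagonal fun k => transferEval (M (blk k)) z

/-- The multiplier `[0, M_ZF^*; M_ZF, -M_ZF H̃ - H̃ M_ZF^*]`. -/
def stagedMultiplier {n N : ℕ} (Ht : Matrix (Fin n) (Fin n) ℝ) (blk : Fin n → Fin N)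
    (M : Fin N → RatFunc ℝ) (z : ℂ) : Matrix (Fin n ⊕ Fin n) (Fin n ⊕ Fin n) ℂ :=
  Matrix.fromBlocks 0 (blockMultiplier blk M z)ᴴ (blockMultiplier blk M z)
    (-(blockMultiplier blk M z * toComplex Ht) - toComplex Ht * (blockMultiplier blk M z)ᴴ)

end

open MeasureTheory AddCircle Topology

noncomputable section

/-! Stationarity of the minimizer u reads θ - H̃u = μ(∇B(u) - mu), and the right side is the
gradient of μ(B - (m/2)‖·‖²), which is convex on the domain by the Hessian bound. Since the row
spaces are mutually orthogonal, moving u within the row space of L_i changes only the barrier terms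
of group i. Hence, with y = L̄_i u, the vector g = L̄_i(θ - H̃u) is a subgradient of V_i = μ(B_i -
(m/2)|y|²) (`groupPotential_le`). Recentering makes every barrier term vanish to first order at 0,
so φ(0) = 0, V_i(0) = 0 and V_i ≥ 0.

For ℓ₂ signals, the subgradient inequality between times t - k and t, summed over t, gives Σ
y_t·g_{t-k} ≤ Σ y_t·g_t (`tsum_shift_le_of_subgradient`). Weighting by h_k ≥ 0 with Σ h_k ≤ H_s and
applying Parseval's identity gives Re ∫ ŷ^* M ĝ ≥ 0 (`zamesFalb_integral_nonneg`). The loop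
transformation turns (θ, u) into (θ - H̃u + u, u), on which the quadratic form of Π is the sum over
i of ŷ^* M_i ĝ and its conjugate (`loopMultiplier_quadratic`).

Existence of φ is compactness of a sublevel set; uniqueness and the Lipschitz bound that puts φ(θ)
in ℓ₂ come from strong monotonicity with constant matrix H̃. For staged constraints, compactness of
the polyhedron gives Σ L̄_iᵀL̄_i = I, so each L̄_iᵀL̄_i is the coordinate projection onto block i
and Π takes its closed form. -/

/-! ### Fourier transforms of square summable sequences. -/

lemma memℓp_two_iff_summable_sq {ι : Type*} (x : ι → ℝ) :
    Memℓp x 2 ↔ Summable fun t => x t ^ 2 := by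
  rw [memℓp_gen_iff (by norm_num)]
  simp

lemma summable_mul_of_sq {ι : Type*} {x y : ι → ℝ} (hx : Summable fun t => x t ^ 2)
    (hy : Summable fun t => y t ^ 2) : Summable fun t => x t * y t := by
  refine Summable.of_norm_bounded (hx.add hy) fun t => ?_
  rw [Real.norm_eq_abs, abs_le]
  constructor <;> nlinarith [sq_nonneg (x t + y t), sq_nonneg (x t - y t)]

lemma memℓp_reverse {x : ℤ → ℝ} (hx : Memℓp x 2) :
    Memℓp (fun k : ℤ => ((x (-k) : ℝ) : ℂ)) 2 := by
  rw [memℓp_two_iff_summable_sq] at hx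
  rw [memℓp_gen_iff (by norm_num)]
  simpa [Function.comp_def] using (Equiv.neg ℤ).summable_iff.mpr hx

/-- The Fourier basis uses e^{+jkω} while the transform uses e^{-jkω}, hence the reflected index in
the coefficients. -/
lemma exists_dtft_lp {x : ℤ → ℝ} (hx : Memℓp x 2) :
    ∃ F : Lp ℂ 2 (haarAddCircle (T := 2 * Real.pi)),
      (∀ k, (fourierBasis (T := 2 * Real.pi)).repr F k = (x (-k) : ℂ)) ∧
        ∀ ω : ℝ, dtft x ω = F (ω : AddCircle (2 * Real.pi)) := by
  refine ⟨(fourierBasis (T := 2 * Real.pi)).repr.symm ⟨_, memℓp_reverse hx⟩, fun k => ?_,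
    fun ω => ?_⟩
  · rw [LinearIsometryEquiv.apply_symm_apply]
  · rw [dtft, dif_pos (memℓp_reverse hx)]

lemma haarAddCircle_lp_ext {F G : Lp ℂ 2 (haarAddCircle (T := 2 * Real.pi))}
    (h : ∀ k, (fourierBasis (T := 2 * Real.pi)).repr F k
      = (fourierBasis (T := 2 * Real.pi)).repr G k) : F = G :=
  (fourierBasis (T := 2 * Real.pi)).repr.injective (lp.ext (funext h))

/-- Almost everywhere statements on the circle pull back to one period. -/
lemma ae_restrict_of_ae_haarAddCircle {p : AddCircle (2 * Real.pi) → Prop}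
    (h : ∀ᵐ t ∂(haarAddCircle (T := 2 * Real.pi)), p t) :
    ∀ᵐ ω : ℝ ∂(volume.restrict (Set.Ioc (-Real.pi) Real.pi)),
      p (ω : AddCircle (2 * Real.pi)) := by
  have hv : ∀ᵐ t ∂(volume : Measure (AddCircle (2 * Real.pi))), p t := by
    rw [volume_eq_smul_haarAddCircle]
    exact Measure.ae_smul_measure h _
  have := (AddCircle.measurePreserving_mk (2 * Real.pi) (-Real.pi)).quasiMeasurePreserving.ae hv
  rwa [show -Real.pi + 2 * Real.pi = Real.pi by ring] at this

lemma dtft_add_smul_ae {x y : ℤ → ℝ} (hx : Memℓp x 2) (hy : Memℓp y 2) (a : ℝ) :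
    ∀ᵐ ω : ℝ ∂(volume.restrict (Set.Ioc (-Real.pi) Real.pi)),
      dtft (fun k => a * x k + y k) ω = a * dtft x ω + dtft y ω := by
  have hz : Memℓp (fun k => a * x k + y k) 2 := (hx.const_mul a).add hy
  obtain ⟨F, hF, hF'⟩ := exists_dtft_lp hx
  obtain ⟨G, hG, hG'⟩ := exists_dtft_lp hy
  obtain ⟨K, hK, hK'⟩ := exists_dtft_lp hz
  have : K = (a : ℂ) • F + G := by
    refine haarAddCircle_lp_ext fun k => ?_
    rw [hK, map_add, map_smul, lp.coeFn_add, Pi.add_apply, lp.coeFn_smul, Pi.smul_apply, hF, hG]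
    simp
  have h1 : ∀ᵐ t ∂(haarAddCircle (T := 2 * Real.pi)), K t = a * F t + G t := by
    rw [this]
    filter_upwards [Lp.coeFn_add ((a : ℂ) • F) G, Lp.coeFn_smul (a : ℂ) F] with t h1 h2
    rw [h1, Pi.add_apply, h2]; rfl
  filter_upwards [ae_restrict_of_ae_haarAddCircle h1] with ω h
  rw [hF', hG', hK', h]

lemma dtft_zero_ae : ∀ᵐ ω : ℝ ∂(volume.restrict (Set.Ioc (-Real.pi) Real.pi)),
      dtft (fun _ => 0) ω = 0 := by
  have h0 : Memℓp (fun _ : ℤ => (0 : ℝ)) 2 := zero_memℓp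
  filter_upwards [dtft_add_smul_ae h0 h0 1] with ω h
  simpa using h

lemma memℓp_finset_sum {ι : Type*} (s : Finset ι) (a : ι → ℝ) {x : ι → ℤ → ℝ}
    (hx : ∀ i, Memℓp (x i) 2) : Memℓp (fun k => ∑ i ∈ s, a i * x i k) 2 := by
  classical
  induction s using Finset.induction_on with
  | empty =>
    simp_rw [Finset.sum_empty]
    exact zero_memℓp
  | insert i s hi ih =>
    simp_rw [Finset.sum_insert hi]
    exact ((hx i).const_mul (a i)).add ih

lemma dtft_sum_ae {ι : Type*} (s : Finset ι) (a : ι → ℝ) {x : ι → ℤ → ℝ}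
    (hx : ∀ i, Memℓp (x i) 2) :
    ∀ᵐ ω : ℝ ∂(volume.restrict (Set.Ioc (-Real.pi) Real.pi)),
      dtft (fun k => ∑ i ∈ s, a i * x i k) ω = ∑ i ∈ s, (a i : ℂ) * dtft (x i) ω := by
  classical
  induction s using Finset.induction_on with
  | empty => simpa using dtft_zero_ae
  | insert i s hi ih =>
    simp_rw [Finset.sum_insert hi]
    filter_upwards [ih, dtft_add_smul_ae (hx i) (memℓp_finset_sum s a hx) (a i)] with ω h1 h2
    rw [h2, h1]

/-! ### Parseval's identity with shifts and with a Zames–Falb symbol. -/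

lemma memLp_fourier_mul (k : ℤ) (G : Lp ℂ 2 (haarAddCircle (T := 2 * Real.pi))) :
    MemLp (fun t => fourier k t * G t) 2 (haarAddCircle (T := 2 * Real.pi)) := by
  refine (Lp.memLp G).congr_norm
    ((map_continuous (fourier k)).aestronglyMeasurable.mul (Lp.aestronglyMeasurable G)) ?_
  refine Filter.Eventually.of_forall fun t => ?_
  rw [norm_mul, fourier_apply, Circle.norm_coe, one_mul]

lemma fourierCoeff_fourier_mul (k n : ℤ) (G : AddCircle (2 * Real.pi) → ℂ) :
    fourierCoeff (fun t => fourier (-k) t * G t) n = fourierCoeff G (n + k) := by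
  unfold fourierCoeff
  congr 1
  ext t
  rw [smul_eq_mul, smul_eq_mul, ← mul_assoc, ← fourier_add, neg_add]

/-- Parseval's identity with a shift. -/
lemma integral_star_mul_fourier_mul {x y : ℤ → ℝ}
    {F G : Lp ℂ 2 (haarAddCircle (T := 2 * Real.pi))}
    (hF : ∀ k, (fourierBasis (T := 2 * Real.pi)).repr F k = (x (-k) : ℂ))
    (hG : ∀ k, (fourierBasis (T := 2 * Real.pi)).repr G k = (y (-k) : ℂ)) (k : ℤ) :
    Integrable (fun t => star (F t) * (fourier (-k) t * G t))
        (haarAddCircle (T := 2 * Real.pi)) ∧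
    ∫ t, star (F t) * (fourier (-k) t * G t) ∂(haarAddCircle (T := 2 * Real.pi))
      = ((∑' t, x t * y (t - k) : ℝ) : ℂ) := by
  set K := (memLp_fourier_mul (-k) G).toLp with hKdef
  have hKae : K =ᵐ[haarAddCircle] fun t => fourier (-k) t * G t := MemLp.coeFn_toLp _
  have hK : ∀ n, (fourierBasis (T := 2 * Real.pi)).repr K n = (y (-(n + k)) : ℂ) := by
    intro n
    rw [fourierBasis_repr, fourierCoeff_congr_ae hKae, fourierCoeff_fourier_mul,
      ← fourierBasis_repr, hG]
  have hI : (fun t => inner ℂ (F t) (K t)) =ᵐ[haarAddCircle]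
      fun t => star (F t) * (fourier (-k) t * G t) := by
    filter_upwards [hKae] with t ht
    rw [ht, RCLike.inner_apply, mul_comm]; rfl
  refine ⟨(L2.integrable_inner F K).congr hI, ?_⟩
  rw [← integral_congr_ae hI, ← L2.inner_def,
    ← (fourierBasis (T := 2 * Real.pi)).repr.inner_map_map, lp.inner_eq_tsum]
  simp_rw [hF, hK]
  -- The substitution n ↦ -n undoes the reflection of the coefficients.
  rw [← (Equiv.neg ℤ).tsum_eq, Complex.ofReal_tsum]
  congr 1
  ext n
  simp only [Equiv.neg_apply, neg_neg, RCLike.inner_apply, Complex.conj_ofReal]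
  rw [Complex.ofReal_mul, mul_comm, show -(-n + k) = n - k by ring]

lemma exp_zpow_eq_fourier (k : ℤ) (ω : ℝ) :
    Complex.exp (ω * Complex.I) ^ k = fourier k (ω : AddCircle (2 * Real.pi)) := by
  rw [fourier_coe_apply, ← Complex.exp_int_mul]
  congr 1
  have : (Real.pi : ℂ) ≠ 0 := by exact_mod_cast Real.pi_ne_zero
  push_cast
  field_simp

lemma norm_fourier_apply (k : ℤ) (t : AddCircle (2 * Real.pi)) : ‖fourier k t‖ = 1 := by
  rw [fourier_apply, Circle.norm_coe]

/-- The series of M is integrated term by term: the k-th term has modulus h_k |F̄G|, so the L¹ norms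
are summable, and each integral is a shifted Parseval sum. The factor 2π is the mass of the period
relative to normalized Haar measure. -/
theorem integral_zamesFalb {x y h : ℤ → ℝ} {Hs : ℝ} {M : RatFunc ℝ}
    (hx : Memℓp x 2) (hy : Memℓp y 2) (hh : Summable h) (h0 : ∀ k, 0 ≤ h k)
    (hM : ∀ z : ℂ, ‖z‖ = 1 → transferEval M z = (Hs : ℂ) - ∑' k : ℤ, (h k : ℂ) * z ^ (-k)) :
    IntervalIntegrable (fun ω : ℝ => star (dtft x ω)
        * (transferEval M (Complex.exp (ω * Complex.I)) * dtft y ω)) volume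
        (-Real.pi) Real.pi ∧
    ∃ s : ℝ, HasSum (fun k => h k * ∑' t, x t * y (t - k)) s ∧
    ∫ ω in (-Real.pi)..Real.pi, star (dtft x ω)
        * (transferEval M (Complex.exp (ω * Complex.I)) * dtft y ω)
      = ((2 * Real.pi * (Hs * ∑' t, x t * y t - s) : ℝ) : ℂ) := by
  obtain ⟨F, hF, hF'⟩ := exists_dtft_lp hx
  obtain ⟨G, hG, hG'⟩ := exists_dtft_lp hy
  have hP := integral_star_mul_fourier_mul hF hG
  set J : AddCircle (2 * Real.pi) → ℂ := fun t =>
    star (F t) * (Hs * G t) - ∑' k, (h k : ℂ) * (star (F t) * (fourier (-k) t * G t)) with hJ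
  have hJω : (fun ω : ℝ => star (dtft x ω)
        * (transferEval M (Complex.exp (ω * Complex.I)) * dtft y ω))
      = fun ω : ℝ => J (ω : AddCircle (2 * Real.pi)) := by
    ext ω
    rw [hM _ (Complex.norm_exp_ofReal_mul_I ω), hF', hG', hJ]
    simp_rw [exp_zpow_eq_fourier]
    rw [sub_mul, mul_sub, ← tsum_mul_right, ← tsum_mul_left]
    congr 2
    ext k
    ring
  have hFG : Integrable (fun t => star (F t) * G t) (haarAddCircle (T := 2 * Real.pi)) := by
    simpa using (hP 0).1
  have hFG' : ∫ t, star (F t) * G t ∂(haarAddCircle (T := 2 * Real.pi))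
      = ((∑' t, x t * y t : ℝ) : ℂ) := by simpa using (hP 0).2
  have hi : ∀ k, Integrable (fun t => (h k : ℂ) * (star (F t) * (fourier (-k) t * G t)))
      (haarAddCircle (T := 2 * Real.pi)) := fun k => (hP k).1.const_mul _
  have hnorm : ∀ k t, ‖(h k : ℂ) * (star (F t) * (fourier (-k) t * G t))‖
      = h k * ‖star (F t) * G t‖ := by
    intro k t
    rw [norm_mul, norm_mul, norm_mul, norm_fourier_apply, norm_mul, one_mul, Complex.norm_real,
      Real.norm_of_nonneg (h0 k)]
  have hs : Summable fun k => ∫ t, ‖(h k : ℂ) * (star (F t) * (fourier (-k) t * G t))‖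
      ∂(haarAddCircle (T := 2 * Real.pi)) := by
    simp_rw [hnorm, integral_const_mul]
    exact hh.mul_right _
  have hsum := hasSum_integral_of_summable_integral_norm hi hs
  have hsumint : Integrable (fun t => ∑' k, (h k : ℂ) * (star (F t) * (fourier (-k) t * G t)))
      (haarAddCircle (T := 2 * Real.pi)) := by
    -- Factored as a bounded continuous symbol times the integrable function F̄G.
    have hc : Continuous fun t : AddCircle (2 * Real.pi) => ∑' k, (h k : ℂ) * fourier (-k) t := by
      refine continuous_tsum (fun k => continuous_const.mul (map_continuous (fourier (-k)))) hh ?_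
      intro k t
      rw [norm_mul, norm_fourier_apply, mul_one, Complex.norm_real, Real.norm_of_nonneg (h0 k)]
    have hb : Integrable (fun t => (∑' k, (h k : ℂ) * fourier (-k) t) * (star (F t) * G t))
        (haarAddCircle (T := 2 * Real.pi)) := by
      refine hFG.bdd_mul (c := ∑' k, h k) hc.aestronglyMeasurable
        (Filter.Eventually.of_forall fun t => ?_)
      refine tsum_of_norm_bounded hh.hasSum fun k => ?_
      rw [norm_mul, norm_fourier_apply, mul_one, Complex.norm_real, Real.norm_of_nonneg (h0 k)]
    refine hb.congr (Filter.Eventually.of_forall fun t => ?_)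
    simp only
    rw [← tsum_mul_right]
    congr 1
    ext k
    ring
  have hJint : Integrable J (haarAddCircle (T := 2 * Real.pi)) := by
    refine Integrable.sub ?_ hsumint
    refine (hFG.const_mul (Hs : ℂ)).congr (Filter.Eventually.of_forall fun t => ?_)
    simp only
    ring
  have hper : -Real.pi + 2 * Real.pi = Real.pi := by ring
  have hvol : Integrable J (volume : Measure (AddCircle (2 * Real.pi))) := by
    rw [volume_eq_smul_haarAddCircle]
    exact hJint.smul_measure ENNReal.ofReal_ne_top
  refine ⟨?_, ∑' k, h k * ∑' t, x t * y (t - k), ?_, ?_⟩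
  · rw [hJω, intervalIntegrable_iff_integrableOn_Ioc_of_le (by linarith [Real.pi_pos])]
    have := (AddCircle.measurePreserving_mk (2 * Real.pi) (-Real.pi)).integrable_comp_of_integrable
      hvol
    rwa [hper] at this
  · refine Summable.hasSum ?_
    have : Summable fun k => ((h k * ∑' t, x t * y (t - k) : ℝ) : ℂ) := by
      refine hsum.summable.congr fun k => ?_
      rw [integral_const_mul, (hP k).2]
      push_cast; rfl
    exact Complex.summable_ofReal.mp this
  · rw [hJω]
    have h1 := AddCircle.intervalIntegral_preimage (2 * Real.pi) (-Real.pi) J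
    rw [hper] at h1
    rw [h1, volume_eq_smul_haarAddCircle, integral_smul_measure,
      ENNReal.toReal_ofReal Real.two_pi_pos.le, hJ, integral_sub _ hsumint, ← hsum.tsum_eq]
    · have h2 : ∫ t, star (F t) * (Hs * G t) ∂(haarAddCircle (T := 2 * Real.pi))
          = Hs * ((∑' t, x t * y t : ℝ) : ℂ) := by
        rw [← hFG', ← integral_const_mul]
        congr 1
        ext t
        ring
      rw [h2]
      simp_rw [integral_const_mul, (hP _).2]
      rw [Complex.real_smul]
      push_cast
      rfl
    · refine (hFG.const_mul (Hs : ℂ)).congr (Filter.Eventually.of_forall fun t => ?_)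
      simp only
      ring

/-! ### The Zames–Falb inequality in time and frequency. -/

lemma summable_comp_sub_right {f : ℤ → ℝ} (hf : Summable f) (k : ℤ) :
    Summable fun t => f (t - k) :=
  (Equiv.subRight k).summable_iff.mpr hf

lemma tsum_comp_sub_right (f : ℤ → ℝ) (k : ℤ) : ∑' t, f (t - k) = ∑' t, f t :=
  (Equiv.subRight k).tsum_eq f

/-- Time domain Zames–Falb inequality for a signal pair `(y, g)` with `g` a subgradient selection
of a nonnegative convex function vanishing at the origin, evaluated along `y`. -/
theorem tsum_shift_le_of_subgradient {p : ℕ} {y g : ℤ → Fin p → ℝ} {V : ℤ → ℝ}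
    (hy : ∀ a, Summable fun t => y t a ^ 2) (hg : ∀ a, Summable fun t => g t a ^ 2)
    (hV0 : ∀ t, 0 ≤ V t) (hV1 : ∀ t, V t ≤ y t ⬝ᵥ g t)
    (hV : ∀ s t, V t + (y s - y t) ⬝ᵥ g t ≤ V s) (k : ℤ) :
    ∑ a, ∑' t, y t a * g (t - k) a ≤ ∑ a, ∑' t, y t a * g t a := by
  have hyg : ∀ a, Summable fun t => y t a * g t a := fun a => summable_mul_of_sq (hy a) (hg a)
  have hgk : ∀ a, Summable fun t => g (t - k) a ^ 2 := fun a =>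
    summable_comp_sub_right (hg a) k
  have hygk : ∀ a, Summable fun t => y t a * g (t - k) a := fun a =>
    summable_mul_of_sq (hy a) (hgk a)
  have e1 := Summable.tsum_finsetSum (s := Finset.univ) fun a _ => hygk a
  have e2 := Summable.tsum_finsetSum (s := Finset.univ) fun a _ => hyg a
  rw [← e1, ← e2]
  have hd : Summable fun t => ∑ a, y t a * g t a := summable_sum fun a _ => hyg a
  have hdk : Summable fun t => ∑ a, y t a * g (t - k) a := summable_sum fun a _ => hygk a
  -- V is squeezed between 0 and the summable y·g.
  have hVs : Summable V := Summable.of_nonneg_of_le hV0 hV1 hd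
  have hdV : Summable fun t => (∑ a, y t a * g t a) - V t := hd.sub hVs
  have hdVk : Summable fun t => (∑ a, y (t - k) a * g (t - k) a) - V (t - k) :=
    summable_comp_sub_right hdV k
  have t1 : ∑' t, ((∑ a, y (t - k) a * g (t - k) a) - V (t - k))
      = ∑' t, ((∑ a, y t a * g t a) - V t) :=
    tsum_comp_sub_right (fun t => (∑ a, y t a * g t a) - V t) k
  -- The subgradient at time t - k is tested at y t. After summation V t and V (t - k) cancel by
  -- shift invariance.
  have key : ∑' t, ∑ a, y t a * g (t - k) a
      ≤ ∑' t, (V t + ((∑ a, y (t - k) a * g (t - k) a) - V (t - k))) := by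
    refine Summable.tsum_le_tsum (fun t => ?_) hdk (hVs.add hdVk)
    have := hV t (t - k)
    rw [sub_dotProduct] at this
    simp only [dotProduct] at this
    linarith
  rw [hVs.tsum_add hdVk, t1, hd.tsum_sub hVs] at key
  linarith

/-- Frequency domain form of the Zames–Falb inequality. -/
theorem zamesFalb_integral_nonneg {p : ℕ} {y g : ℤ → Fin p → ℝ} {V : ℤ → ℝ} {M : RatFunc ℝ}
    (hM : IsZamesFalbPlus M)
    (hy : ∀ a, Memℓp (fun t => y t a) 2) (hg : ∀ a, Memℓp (fun t => g t a) 2)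
    (hV0 : ∀ t, 0 ≤ V t) (hV1 : ∀ t, V t ≤ y t ⬝ᵥ g t)
    (hV : ∀ s t, V t + (y s - y t) ⬝ᵥ g t ≤ V s) :
    IntervalIntegrable (fun ω : ℝ => ∑ a, star (dtft (fun t => y t a) ω)
        * (transferEval M (Complex.exp (ω * Complex.I)) * dtft (fun t => g t a) ω)) volume
        (-Real.pi) Real.pi ∧
    0 ≤ (∫ ω in (-Real.pi)..Real.pi, ∑ a, star (dtft (fun t => y t a) ω)
        * (transferEval M (Complex.exp (ω * Complex.I)) * dtft (fun t => g t a) ω)).re := by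
  obtain ⟨-, Hs, h, hh, h0, hle, hev⟩ := hM
  simp_rw [abs_of_nonneg (h0 _)] at hle
  choose hint s hs hval using fun a => integral_zamesFalb (hy a) (hg a) hh h0 hev
  simp_rw [memℓp_two_iff_summable_sq] at hy hg
  have hFi : ∀ a ∈ (Finset.univ : Finset (Fin p)),
      IntervalIntegrable (fun ω : ℝ => star (dtft (fun t => y t a) ω)
        * (transferEval M (Complex.exp (ω * Complex.I)) * dtft (fun t => g t a) ω)) volume
        (-Real.pi) Real.pi := fun a _ => hint a
  refine ⟨by simpa [Finset.sum_fn] using IntervalIntegrable.sum Finset.univ hFi, ?_⟩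
  rw [intervalIntegral.integral_finsetSum hFi]
  simp_rw [hval]
  rw [← Complex.ofReal_sum, Complex.ofReal_re, ← Finset.mul_sum, Finset.sum_sub_distrib,
    ← Finset.mul_sum]
  refine mul_nonneg Real.two_pi_pos.le (sub_nonneg.mpr ?_)
  -- The sign of Σ y·g is what allows Σ h to be replaced by the larger `Hs`.
  have hnn : 0 ≤ ∑ a, ∑' t, y t a * g t a := by
    rw [← Summable.tsum_finsetSum fun a _ => summable_mul_of_sq (hy a) (hg a)]
    exact tsum_nonneg fun t => (hV0 t).trans (hV1 t)
  have hst : HasSum (fun k => ∑ a, h k * ∑' t, y t a * g (t - k) a) (∑ a, s a) :=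
    hasSum_sum fun a _ => hs a
  calc ∑ a, s a ≤ (∑' k, h k) * ∑ a, ∑' t, y t a * g t a := by
        refine hasSum_le (fun k => ?_) hst (hh.hasSum.mul_right _)
        rw [← Finset.mul_sum]
        exact mul_le_mul_of_nonneg_left (tsum_shift_le_of_subgradient hy hg hV0 hV1 hV k) (h0 k)
    _ ≤ Hs * ∑ a, ∑' t, y t a * g t a := mul_le_mul_of_nonneg_right hle hnn

/-! ### Derivatives of the relaxed logarithm. -/

lemma HasDerivAt.ite_lt {f g : ℝ → ℝ} {f' a : ℝ} (hf : HasDerivAt f f' a) (hg : HasDerivAt g f' a)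
    (h : f a = g a) : HasDerivAt (fun t => if a < t then f t else g t) f' a := by
  have h1 : HasDerivWithinAt (fun t => if a < t then f t else g t) f' (Set.Iic a) a :=
    hg.hasDerivWithinAt.congr (fun t ht => if_neg (not_lt.mpr ht)) (if_neg (lt_irrefl a))
  have h2 : HasDerivWithinAt (fun t => if a < t then f t else g t) f' (Set.Ici a) a := by
    refine hf.hasDerivWithinAt.congr (fun t ht => ?_) (by rw [if_neg (lt_irrefl a), h])
    rcases (Set.mem_Ici.mp ht).eq_or_lt with rfl | hlt
    · rw [if_neg (lt_irrefl _), h]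
    · exact if_pos hlt
  simpa [Set.Iic_union_Ici] using h1.union h2

lemma HasDerivAt.ite_lt_of_ne {f g : ℝ → ℝ} {f' a t : ℝ} (hf : a < t → HasDerivAt f f' t)
    (hg : t < a → HasDerivAt g f' t) (h : t ≠ a) :
    HasDerivAt (fun t => if a < t then f t else g t) f' t := by
  rcases lt_or_gt_of_ne h with hlt | hgt
  · refine (hg hlt).congr_of_eventuallyEq ?_
    filter_upwards [gt_mem_nhds hlt] with s hs using if_neg (not_lt.mpr (le_of_lt hs))
  · refine (hf hgt).congr_of_eventuallyEq ?_
    filter_upwards [lt_mem_nhds hgt] with s hs using if_pos hs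

/-- First derivative of `relaxedNegLog δ`. -/
def relaxedNegLogDeriv (δ t : ℝ) : ℝ := if δ < t then -t⁻¹ else (t - 2 * δ) / δ ^ 2

/-- Second derivative of `relaxedNegLog δ`. -/
def relaxedNegLogDeriv2 (δ t : ℝ) : ℝ := if δ < t then (t ^ 2)⁻¹ else (δ ^ 2)⁻¹

lemma relaxedNegLogDeriv2_nonneg (δ t : ℝ) : 0 ≤ relaxedNegLogDeriv2 δ t := by
  unfold relaxedNegLogDeriv2
  split_ifs <;> positivity

lemma hasDerivAt_relaxedNegLog {δ t : ℝ} (hδ : 0 ≤ δ) (ht : δ = 0 → 0 < t) :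
    HasDerivAt (relaxedNegLog δ) (relaxedNegLogDeriv δ t) t := by
  have hlog : ∀ {s : ℝ}, s ≠ 0 → HasDerivAt (fun t => -Real.log t) (-s⁻¹) s := fun hs =>
    (Real.hasDerivAt_log hs).neg
  have hquad : ∀ {s : ℝ}, δ ≠ 0 → HasDerivAt
      (fun t => (1 / 2) * (((t - 2 * δ) / δ) ^ 2 - 1) - Real.log δ) ((s - 2 * δ) / δ ^ 2) s := by
    intro s hd
    have h := (((((hasDerivAt_id s).sub_const (2 * δ)).div_const δ).pow 2).sub_const 1).const_mul
      ((1 : ℝ) / 2) |>.sub_const (Real.log δ)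
    refine h.congr_deriv ?_
    simp only [id]
    field_simp
    norm_num
    field_simp
  rcases eq_or_ne t δ with rfl | hne
  -- At the junction both branches share value and slope; δ = 0 is excluded there by the
  -- admissibility condition.
  · have ht0 : t ≠ 0 := fun h => (ht h).ne' h
    have hd : relaxedNegLogDeriv t t = -t⁻¹ := by
      rw [relaxedNegLogDeriv, if_neg (lt_irrefl t)]
      field_simp
      ring
    rw [hd]
    refine HasDerivAt.ite_lt (hlog ht0) ?_ ?_
    · refine (hquad ht0).congr_deriv ?_
      field_simp
      ring
    · field_simp
      ring
  · refine HasDerivAt.ite_lt_of_ne (fun h => ?_) (fun h => ?_) hne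
    · rw [relaxedNegLogDeriv, if_pos h]
      exact hlog (hδ.trans_lt h).ne'
    · rw [relaxedNegLogDeriv, if_neg (not_lt.mpr h.le)]
      exact hquad fun h0 => absurd (ht h0) (not_lt.mpr (h0 ▸ h.le))

lemma hasDerivAt_relaxedNegLogDeriv {δ t : ℝ} (hδ : 0 ≤ δ) (ht : δ = 0 → 0 < t) :
    HasDerivAt (relaxedNegLogDeriv δ) (relaxedNegLogDeriv2 δ t) t := by
  have hlog : ∀ {s : ℝ}, s ≠ 0 → HasDerivAt (fun t : ℝ => -t⁻¹) ((s ^ 2)⁻¹) s := fun hs =>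
    (hasDerivAt_inv hs).neg.congr_deriv (neg_neg _)
  have hquad : ∀ {s : ℝ}, HasDerivAt (fun t => (t - 2 * δ) / δ ^ 2) ((δ ^ 2)⁻¹) s := by
    intro s
    refine (((hasDerivAt_id s).sub_const (2 * δ)).div_const (δ ^ 2)).congr_deriv ?_
    rw [one_div]
  rcases eq_or_ne t δ with rfl | hne
  · have ht0 : t ≠ 0 := fun h => (ht h).ne' h
    rw [relaxedNegLogDeriv2, if_neg (lt_irrefl t)]
    refine HasDerivAt.ite_lt (hlog ht0) hquad ?_
    field_simp
    ring
  · refine HasDerivAt.ite_lt_of_ne (fun h => ?_) (fun h => ?_) hne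
    · rw [relaxedNegLogDeriv2, if_pos h]
      exact hlog (hδ.trans_lt h).ne'
    · rw [relaxedNegLogDeriv2, if_neg (not_lt.mpr h.le)]
      exact hquad

/-- First order lower bound for a function with nonnegative second derivative. -/
lemma add_deriv_le_of_deriv2_nonneg {f f' f'' : ℝ → ℝ}
    (h1 : ∀ t ∈ Set.Icc (0 : ℝ) 1, HasDerivAt f (f' t) t)
    (h2 : ∀ t ∈ Set.Icc (0 : ℝ) 1, HasDerivAt f' (f'' t) t)
    (h3 : ∀ t ∈ Set.Icc (0 : ℝ) 1, 0 ≤ f'' t) : f 0 + f' 0 ≤ f 1 := by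
  -- Mean value theorem twice: f 1 - f 0 = f' a, and f' a - f' 0 = a f'' b ≥ 0.
  obtain ⟨a, ha, hfa⟩ := exists_hasDerivAt_eq_slope f f' zero_lt_one
    (fun t ht => (h1 t ht).continuousAt.continuousWithinAt)
    (fun t ht => h1 t (Set.Ioo_subset_Icc_self ht))
  have hsub : Set.Icc 0 a ⊆ Set.Icc (0 : ℝ) 1 := Set.Icc_subset_Icc_right ha.2.le
  obtain ⟨b, hb, hfb⟩ := exists_hasDerivAt_eq_slope f' f'' ha.1
    (fun t ht => (h2 t (hsub ht)).continuousAt.continuousWithinAt)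
    (fun t ht => h2 t (hsub (Set.Ioo_subset_Icc_self ht)))
  have hnn := h3 b (hsub (Set.Ioo_subset_Icc_self hb))
  rw [hfb, sub_zero, le_div_iff₀ ha.1, zero_mul] at hnn
  rw [sub_zero, div_one] at hfa
  linarith

/-! ### Calculus and strong convexity of the recentered barrier. -/

namespace BarrierConstraints

variable {n N : ℕ} (C : BarrierConstraints n N)

/-- The linear functional `u ↦ L_{ij} u`. -/
def row (i : Fin N) (j : Fin (C.r i)) : EuclideanSpace ℝ (Fin n) →L[ℝ] ℝ :=
  LinearMap.toContinuousLinearMap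
    { toFun := fun u => (C.L i *ᵥ WithLp.ofLp u) j
      map_add' := fun u v => by simp [Matrix.mulVec_add]
      map_smul' := fun a u => by simp [Matrix.mulVec_smul] }

lemma row_apply (i : Fin N) (j : Fin (C.r i)) (u : EuclideanSpace ℝ (Fin n)) :
    C.row i j u = (C.L i *ᵥ WithLp.ofLp u) j := rfl

/-- The contribution of row `(i, j)` to the barrier, as a function of `s = L_{ij} u`. -/
def term (i : Fin N) (j : Fin (C.r i)) (s : ℝ) : ℝ :=
  C.c i j * (relaxedNegLog (C.δ i j) (C.W i j - s) + Real.log (C.W i j) - s / C.W i j)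

/-- First derivative of `term`. -/
def termDeriv (i : Fin N) (j : Fin (C.r i)) (s : ℝ) : ℝ :=
  C.c i j * (-relaxedNegLogDeriv (C.δ i j) (C.W i j - s) - (C.W i j)⁻¹)

/-- Second derivative of `term`. -/
def termDeriv2 (i : Fin N) (j : Fin (C.r i)) (s : ℝ) : ℝ :=
  C.c i j * relaxedNegLogDeriv2 (C.δ i j) (C.W i j - s)

variable {C} in
lemma barrier_eq (u : EuclideanSpace ℝ (Fin n)) :
    C.barrier u = ∑ i, ∑ j, C.term i j (C.row i j u) := rfl

variable {C} in
lemma mem_domain {u : EuclideanSpace ℝ (Fin n)} :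
    u ∈ C.domain ↔ ∀ i j, C.δ i j = 0 → C.row i j u < C.W i j := Iff.rfl

lemma hasDerivAt_term {i : Fin N} {j : Fin (C.r i)} {s : ℝ} (h : C.δ i j = 0 → s < C.W i j) :
    HasDerivAt (C.term i j) (C.termDeriv i j s) s := by
  have h1 : HasDerivAt (fun s => C.W i j - s) (-1) s := (hasDerivAt_id s).const_sub _
  have h2 := (hasDerivAt_relaxedNegLog (C.δ_nonneg i j)
    (fun h0 => sub_pos.mpr (h h0))).comp s h1
  refine (((h2.add_const (Real.log (C.W i j))).sub
    ((hasDerivAt_id s).div_const (C.W i j))).const_mul (C.c i j)).congr_deriv ?_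
  rw [termDeriv, one_div]
  ring

lemma hasDerivAt_termDeriv {i : Fin N} {j : Fin (C.r i)} {s : ℝ}
    (h : C.δ i j = 0 → s < C.W i j) :
    HasDerivAt (C.termDeriv i j) (C.termDeriv2 i j s) s := by
  have h1 : HasDerivAt (fun s => C.W i j - s) (-1) s := (hasDerivAt_id s).const_sub _
  have h2 := (hasDerivAt_relaxedNegLogDeriv (C.δ_nonneg i j)
    (fun h0 => sub_pos.mpr (h h0))).comp s h1
  refine ((h2.neg.sub_const (C.W i j)⁻¹).const_mul (C.c i j)).congr_deriv ?_
  rw [termDeriv2]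
  ring

lemma termDeriv2_nonneg (i : Fin N) (j : Fin (C.r i)) (s : ℝ) : 0 ≤ C.termDeriv2 i j s :=
  mul_nonneg (C.c_pos i j).le (relaxedNegLogDeriv2_nonneg _ _)

/-- This is the recentering. The bound δ ≤ W puts s = 0 on the logarithmic branch or, if δ = W,
exactly at the junction, where the quadratic agrees with it. -/
lemma term_zero (i : Fin N) (j : Fin (C.r i)) : C.term i j 0 = 0 := by
  have hW := C.W_pos i j
  rw [term, sub_zero, zero_div, sub_zero, relaxedNegLog]
  split_ifs with h
  · ring
  · have he : C.δ i j = C.W i j := le_antisymm (C.δ_le i j) (not_lt.mp h)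
    rw [he]
    field_simp
    ring

lemma termDeriv_zero (i : Fin N) (j : Fin (C.r i)) : C.termDeriv i j 0 = 0 := by
  have hW := C.W_pos i j
  rw [termDeriv, sub_zero, relaxedNegLogDeriv]
  split_ifs with h
  · ring
  · have he : C.δ i j = C.W i j := le_antisymm (C.δ_le i j) (not_lt.mp h)
    rw [he]
    field_simp
    ring

/-- Segments between admissible row values stay admissible. -/
lemma segment_lt {i : Fin N} {j : Fin (C.r i)} {s d t : ℝ} (h0 : s < C.W i j)
    (h1 : s + d < C.W i j) (ht : t ∈ Set.Icc (0 : ℝ) 1) : s + t * d < C.W i j := by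
  obtain ⟨ht0, ht1⟩ := ht
  rcases le_total d 0 with hd | hd
  · nlinarith
  · nlinarith

/-- Each term is convex along the segment from 0 to s, with zero value and zero slope at 0. -/
lemma term_nonneg {i : Fin N} {j : Fin (C.r i)} {s : ℝ} (h : C.δ i j = 0 → s < C.W i j) :
    0 ≤ C.term i j s := by
  have hadm : ∀ t ∈ Set.Icc (0 : ℝ) 1, C.δ i j = 0 → t * s < C.W i j := by
    intro t ht h0
    simpa using C.segment_lt (C.W_pos i j) (by simpa using h h0) ht
  have hl : ∀ t : ℝ, HasDerivAt (fun t => t * s) s t := fun t => by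
    simpa using (hasDerivAt_id t).mul_const s
  have := add_deriv_le_of_deriv2_nonneg (f := fun t => C.term i j (t * s))
    (f' := fun t => C.termDeriv i j (t * s) * s)
    (f'' := fun t => C.termDeriv2 i j (t * s) * s * s)
    (fun t ht => by
      have h1 := (C.hasDerivAt_term (hadm t ht)).comp t (hl t)
      exact h1)
    (fun t ht => by
      have h2 := ((C.hasDerivAt_termDeriv (hadm t ht)).comp t (hl t)).mul_const s
      exact h2)
    (fun t ht => by
      rw [mul_assoc]
      exact mul_nonneg (C.termDeriv2_nonneg i j _) (mul_self_nonneg s))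
  simpa [term_zero, termDeriv_zero] using this

/-- The differential of the barrier. -/
def barrierDeriv (u : EuclideanSpace ℝ (Fin n)) : EuclideanSpace ℝ (Fin n) →L[ℝ] ℝ :=
  ∑ i, ∑ j, C.termDeriv i j (C.row i j u) • C.row i j

lemma barrierDeriv_apply (u d : EuclideanSpace ℝ (Fin n)) :
    C.barrierDeriv u d = ∑ i, ∑ j, C.termDeriv i j (C.row i j u) * C.row i j d := by
  simp [barrierDeriv]

variable {C} in
lemma hasFDerivAt_barrier {u : EuclideanSpace ℝ (Fin n)} (hu : u ∈ C.domain) :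
    HasFDerivAt C.barrier (C.barrierDeriv u) u := by
  refine HasFDerivAt.fun_sum fun i _ => HasFDerivAt.fun_sum fun j _ => ?_
  have := HasDerivAt.comp_hasFDerivAt u (h₂ := C.term i j) (f := C.row i j)
    (C.hasDerivAt_term (hu i j)) (C.row i j).hasFDerivAt
  exact this

variable {C} in
lemma hasFDerivAt_barrierDeriv {u : EuclideanSpace ℝ (Fin n)} (hu : u ∈ C.domain) :
    HasFDerivAt C.barrierDeriv
      (∑ i, ∑ j, (C.termDeriv2 i j (C.row i j u) • C.row i j).smulRight (C.row i j)) u := by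
  refine HasFDerivAt.fun_sum fun i _ => HasFDerivAt.fun_sum fun j _ => ?_
  exact ((C.hasDerivAt_termDeriv (hu i j)).comp_hasFDerivAt u
    (C.row i j).hasFDerivAt).smul_const (C.row i j)

lemma isOpen_domain : IsOpen C.domain := by
  have : C.domain = ⋂ i, ⋂ j, {u | C.δ i j = 0 → C.row i j u < C.W i j} := by
    ext u
    simp [mem_domain]
  rw [this]
  refine isOpen_iInter_of_finite fun i => isOpen_iInter_of_finite fun j => ?_
  by_cases h : C.δ i j = 0
  · simpa [h] using isOpen_lt (C.row i j).continuous continuous_const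
  · simp [h]

lemma zero_mem_domain : (0 : EuclideanSpace ℝ (Fin n)) ∈ C.domain := fun i j _ => by
  simpa using C.W_pos i j

variable {C} in
lemma iteratedFDeriv_two_barrier {u : EuclideanSpace ℝ (Fin n)} (hu : u ∈ C.domain)
    (d : EuclideanSpace ℝ (Fin n)) :
    iteratedFDeriv ℝ 2 C.barrier u ![d, d]
      = ∑ i, ∑ j, C.termDeriv2 i j (C.row i j u) * C.row i j d * C.row i j d := by
  have he : fderiv ℝ C.barrier =ᶠ[𝓝 u] C.barrierDeriv := by
    filter_upwards [C.isOpen_domain.mem_nhds hu] with v hv using (hasFDerivAt_barrier hv).fderiv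
  rw [iteratedFDeriv_two_apply, he.fderiv_eq, (hasFDerivAt_barrierDeriv hu).fderiv]
  simp

variable {C} in
lemma segment_mem_domain {u d : EuclideanSpace ℝ (Fin n)} (hu : u ∈ C.domain)
    (hud : u + d ∈ C.domain) {t : ℝ} (ht : t ∈ Set.Icc (0 : ℝ) 1) : u + t • d ∈ C.domain := by
  intro i j h0
  have h1 := mem_domain.mp hu i j h0
  have h2 := mem_domain.mp hud i j h0
  rw [map_add] at h2
  change C.row i j (u + t • d) < _
  rw [map_add, map_smul, smul_eq_mul]
  exact C.segment_lt h1 h2 ht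

lemma hasDerivAt_line (i : Fin N) (j : Fin (C.r i)) (u d : EuclideanSpace ℝ (Fin n)) (t : ℝ) :
    HasDerivAt (fun t : ℝ => C.row i j (u + t • d)) (C.row i j d) t := by
  simp_rw [map_add, map_smul, smul_eq_mul]
  simpa using ((hasDerivAt_id t).mul_const (C.row i j d)).const_add (C.row i j u)

lemma hasDerivAt_barrier_line {u d : EuclideanSpace ℝ (Fin n)} {t : ℝ}
    (h : u + t • d ∈ C.domain) :
    HasDerivAt (fun t : ℝ => C.barrier (u + t • d)) (C.barrierDeriv (u + t • d) d) t := by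
  rw [barrierDeriv_apply]
  refine HasDerivAt.fun_sum fun i _ => HasDerivAt.fun_sum fun j _ => ?_
  have := (C.hasDerivAt_term (mem_domain.mp h i j)).comp t (C.hasDerivAt_line i j u d t)
  exact this

lemma hasDerivAt_barrierDeriv_line {u d : EuclideanSpace ℝ (Fin n)} {t : ℝ}
    (h : u + t • d ∈ C.domain) :
    HasDerivAt (fun t : ℝ => C.barrierDeriv (u + t • d) d)
      (∑ i, ∑ j, C.termDeriv2 i j (C.row i j (u + t • d)) * C.row i j d * C.row i j d) t := by
  simp_rw [barrierDeriv_apply]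
  refine HasDerivAt.fun_sum fun i _ => HasDerivAt.fun_sum fun j _ => ?_
  exact ((C.hasDerivAt_termDeriv (mem_domain.mp h i j)).comp t
    (C.hasDerivAt_line i j u d t)).mul_const _

variable {C}

/-- Strong convexity of the barrier on its domain. -/
theorem HessianLowerBound.barrier_add_le {m : ℝ} (hB : C.HessianLowerBound m)
    {u d : EuclideanSpace ℝ (Fin n)} (hu : u ∈ C.domain) (hud : u + d ∈ C.domain) :
    C.barrier u + C.barrierDeriv u d + m / 2 * ‖d‖ ^ 2 ≤ C.barrier (u + d) := by
  have hq : ∀ t : ℝ, HasDerivAt (fun t : ℝ => m / 2 * ‖d‖ ^ 2 * t ^ 2) (m * ‖d‖ ^ 2 * t) t :=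
    fun t => ((hasDerivAt_pow 2 t).const_mul (m / 2 * ‖d‖ ^ 2)).congr_deriv (by norm_num; ring)
  have hl : ∀ t : ℝ, HasDerivAt (fun t : ℝ => m * ‖d‖ ^ 2 * t) (m * ‖d‖ ^ 2) t := fun t => by
    simpa using (hasDerivAt_id t).const_mul (m * ‖d‖ ^ 2)
  -- Applied to t ↦ B(u + td) - (m/2)‖d‖²t², whose second derivative is nonnegative by the Hessian
  -- bound.
  have := add_deriv_le_of_deriv2_nonneg
    (fun t ht => (C.hasDerivAt_barrier_line (segment_mem_domain hu hud ht)).sub (hq t))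
    (fun t ht => (C.hasDerivAt_barrierDeriv_line (segment_mem_domain hu hud ht)).sub (hl t))
    (fun t ht => by
      rw [sub_nonneg, ← iteratedFDeriv_two_barrier (segment_mem_domain hu hud ht)]
      exact hB _ (segment_mem_domain hu hud ht) d)
  simp only [Pi.sub_apply, zero_smul, add_zero, one_smul] at this
  linarith

lemma barrier_zero : C.barrier 0 = 0 := by
  simp [barrier_eq, term_zero]

lemma barrierDeriv_zero : C.barrierDeriv 0 = 0 := by
  simp [barrierDeriv, termDeriv_zero]

lemma HessianLowerBound.le_barrier {m : ℝ} (hB : C.HessianLowerBound m)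
    {u : EuclideanSpace ℝ (Fin n)} (hu : u ∈ C.domain) : m / 2 * ‖u‖ ^ 2 ≤ C.barrier u := by
  simpa [barrier_zero, barrierDeriv_zero] using
    hB.barrier_add_le (d := u) C.zero_mem_domain (by simpa using hu)

lemma term_le_barrier {u : EuclideanSpace ℝ (Fin n)} (hu : u ∈ C.domain) (i : Fin N)
    (j : Fin (C.r i)) : C.term i j (C.row i j u) ≤ C.barrier u := by
  have hnn : ∀ i j, 0 ≤ C.term i j (C.row i j u) := fun i j => C.term_nonneg (hu i j)
  calc C.term i j (C.row i j u) ≤ ∑ j, C.term i j (C.row i j u) :=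
        Finset.single_le_sum (f := fun j => C.term i j (C.row i j u))
          (fun j _ => hnn i j) (Finset.mem_univ j)
    _ ≤ C.barrier u := Finset.single_le_sum (f := fun i => ∑ j, C.term i j (C.row i j u))
          (fun i _ => Finset.sum_nonneg fun j _ => hnn i j) (Finset.mem_univ i)

/-- A bound on the barrier keeps the hard constraints uniformly inactive. -/
lemma exists_margin (Q : ℝ) (i : Fin N) (j : Fin (C.r i)) : ∃ ε, 0 < ε ∧
    ∀ u ∈ C.domain, C.barrier u ≤ Q → C.δ i j = 0 → C.row i j u ≤ C.W i j - ε := by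
  -- From c(-log(W - s) + log W - s/W) ≤ Q and s/W ≤ 1 one gets log(W - s) ≥ log W - 1 - Q/c.
  refine ⟨Real.exp (Real.log (C.W i j) - 1 - Q / C.c i j), Real.exp_pos _, fun u hu hQ h0 => ?_⟩
  have hc := C.c_pos i j
  have hW := C.W_pos i j
  have hs := mem_domain.mp hu i j h0
  have ht := (term_le_barrier hu i j).trans hQ
  rw [term, relaxedNegLog, h0, if_pos (sub_pos.mpr hs), mul_comm, ← le_div_iff₀ hc] at ht
  have h1 : C.row i j u / C.W i j ≤ 1 := (div_le_one hW).mpr hs.le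
  have := (Real.le_log_iff_exp_le (sub_pos.mpr hs)).mp
    (show Real.log (C.W i j) - 1 - Q / C.c i j ≤ Real.log (C.W i j - C.row i j u) by linarith)
  linarith

end BarrierConstraints

/-! ### Coercivity, existence, uniqueness and Lipschitz dependence of the minimizer. -/

/-- A positive definite real matrix is coercive. -/
lemma Matrix.PosDef.exists_coercive {n : ℕ} {A : Matrix (Fin n) (Fin n) ℝ} (hA : A.PosDef) :
    ∃ l, 0 < l ∧ ∀ u : EuclideanSpace ℝ (Fin n),
      l * ‖u‖ ^ 2 ≤ WithLp.ofLp u ⬝ᵥ (A *ᵥ WithLp.ofLp u) := by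
  have hcont : Continuous fun u : EuclideanSpace ℝ (Fin n) =>
      WithLp.ofLp u ⬝ᵥ (A *ᵥ WithLp.ofLp u) := by
    simp only [dotProduct, Matrix.mulVec]
    fun_prop
  -- An empty unit sphere means a trivial space, where any constant works.
  rcases (Metric.sphere (0 : EuclideanSpace ℝ (Fin n)) 1).eq_empty_or_nonempty with he | hne
  · refine ⟨1, one_pos, fun u => ?_⟩
    have hu : u = 0 := by
      by_contra hu
      have : ‖u‖⁻¹ • u ∈ Metric.sphere (0 : EuclideanSpace ℝ (Fin n)) 1 := by
        rw [mem_sphere_zero_iff_norm, norm_smul, norm_inv, norm_norm,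
          inv_mul_cancel₀ (norm_ne_zero_iff.mpr hu)]
      rw [he] at this
      exact this
    simp [hu]
  · obtain ⟨w, hw, hmin⟩ := (isCompact_sphere (0 : EuclideanSpace ℝ (Fin n)) 1).exists_isMinOn hne
      hcont.continuousOn
    have hw0 : WithLp.ofLp w ≠ 0 := by
      intro h
      have : w = 0 := by ext a; exact congrFun h a
      rw [this] at hw
      simp at hw
    have hpos := hA.dotProduct_mulVec_pos hw0
    rw [star_trivial] at hpos
    refine ⟨_, hpos, fun u => ?_⟩
    rcases eq_or_ne u 0 with rfl | hu
    · simp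
    have hn : 0 < ‖u‖ := norm_pos_iff.mpr hu
    have hmem : ‖u‖⁻¹ • u ∈ Metric.sphere (0 : EuclideanSpace ℝ (Fin n)) 1 := by
      rw [mem_sphere_zero_iff_norm, norm_smul, norm_inv, norm_norm, inv_mul_cancel₀ hn.ne']
    have := isMinOn_iff.mp hmin _ hmem
    rw [WithLp.ofLp_smul, Matrix.mulVec_smul, smul_dotProduct, dotProduct_smul, smul_eq_mul,
      smul_eq_mul, ← mul_assoc, ← mul_inv, inv_mul_eq_div, le_div_iff₀ (by positivity)] at this
    rw [sq]
    exact this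

lemma norm_sq_eq_dotProduct {n : ℕ} (u : EuclideanSpace ℝ (Fin n)) :
    ‖u‖ ^ 2 = WithLp.ofLp u ⬝ᵥ WithLp.ofLp u := by
  rw [EuclideanSpace.real_norm_sq_eq]
  simp [dotProduct, sq]

lemma dotProduct_le_norm_mul_norm {n : ℕ} (u v : EuclideanSpace ℝ (Fin n)) :
    WithLp.ofLp u ⬝ᵥ WithLp.ofLp v ≤ ‖u‖ * ‖v‖ := by
  have := real_inner_le_norm u v
  rwa [EuclideanSpace.inner_eq_star_dotProduct, star_trivial, dotProduct_comm] at this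

lemma dotProduct_slopeMatrix {n : ℕ} (H : Matrix (Fin n) (Fin n) ℝ) (μ m : ℝ)
    (u v : Fin n → ℝ) :
    v ⬝ᵥ (slopeMatrix H μ m *ᵥ u) = v ⬝ᵥ (H *ᵥ u) + μ * m * (v ⬝ᵥ u) := by
  rw [slopeMatrix, Matrix.add_mulVec, Matrix.smul_mulVec, Matrix.one_mulVec, dotProduct_add,
    dotProduct_smul, smul_eq_mul]

namespace BarrierConstraints

variable {n N : ℕ} {C : BarrierConstraints n N} {H : Matrix (Fin n) (Fin n) ℝ} {μ m : ℝ}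

/-- The bound B(u) ≥ (m/2)‖u‖² moves the curvature of the barrier into the quadratic part, so H̃
supplies coercivity even where H is singular. -/
lemma le_objective (hμ : 0 < μ) (hB : C.HessianLowerBound m)
    (θ : EuclideanSpace ℝ (Fin n)) {u : EuclideanSpace ℝ (Fin n)} (hu : u ∈ C.domain) :
    (1 / 2) * (WithLp.ofLp u ⬝ᵥ (slopeMatrix H μ m *ᵥ WithLp.ofLp u))
      - WithLp.ofLp θ ⬝ᵥ WithLp.ofLp u ≤ C.objective H μ θ u := by
  have := mul_le_mul_of_nonneg_left (hB.le_barrier hu) hμ.le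
  rw [norm_sq_eq_dotProduct] at this
  rw [dotProduct_slopeMatrix, objective]
  linarith

lemma objective_zero (θ : EuclideanSpace ℝ (Fin n)) : C.objective H μ θ 0 = 0 := by
  simp [objective, barrier_zero]

lemma continuousAt_objective (θ : EuclideanSpace ℝ (Fin n)) {u : EuclideanSpace ℝ (Fin n)}
    (hu : u ∈ C.domain) : ContinuousAt (C.objective H μ θ) u := by
  have h1 : ContinuousAt C.barrier u := (hasFDerivAt_barrier hu).continuousAt
  have h2 : Continuous fun u : EuclideanSpace ℝ (Fin n) =>
      (1 / 2) * (WithLp.ofLp u ⬝ᵥ (H *ᵥ WithLp.ofLp u)) - WithLp.ofLp θ ⬝ᵥ WithLp.ofLp u := by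
    simp only [dotProduct, Matrix.mulVec]
    fun_prop
  exact h2.continuousAt.add (continuousAt_const.mul h1)

/-- The objective vanishes at the origin, so only points with nonpositive objective compete. They
are bounded, and their barrier values are bounded, so they lie in a compact set that stays strictly
inside the open domain. -/
theorem exists_isMPCSolution (hμ : 0 < μ) (hB : C.HessianLowerBound m)
    (hH : H.PosSemidef) (hHt : (slopeMatrix H μ m).PosDef) (θ : EuclideanSpace ℝ (Fin n)) :
    ∃ u, C.IsMPCSolution H μ θ u := by
  obtain ⟨l, hl, hcoer⟩ := hHt.exists_coercive
  -- A nonpositive objective forces (l/2)‖u‖² ≤ ‖θ‖‖u‖.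
  set R := 2 * ‖θ‖ / l with hR
  have hR0 : 0 ≤ R := by positivity
  -- Since uᵀHu ≥ 0, a nonpositive objective gives μB(u) ≤ θ·u ≤ ‖θ‖R.
  choose ε hε hmargin using C.exists_margin (‖θ‖ * R / μ)
  set K : Set (EuclideanSpace ℝ (Fin n)) :=
    Metric.closedBall 0 R ∩ ⋂ i, ⋂ j, {u | C.δ i j = 0 → C.row i j u ≤ C.W i j - ε i j} with hK
  have hKdom : K ⊆ C.domain := by
    intro u hu i j h0
    have := Set.mem_iInter.mp (Set.mem_iInter.mp hu.2 i) j h0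
    exact this.trans_lt (by linarith [hε i j])
  have hKc : IsCompact K := by
    refine (isCompact_closedBall _ _).inter_right
      (isClosed_iInter fun i => isClosed_iInter fun j => ?_)
    by_cases h : C.δ i j = 0
    · simpa [h] using isClosed_le (C.row i j).continuous continuous_const
    · simp [h]
  have hsub : ∀ u ∈ C.domain, C.objective H μ θ u ≤ 0 → u ∈ K := by
    intro u hu hle
    have h1 := (le_objective (H := H) hμ hB θ hu).trans hle
    have h2 := hcoer u
    have h3 := dotProduct_le_norm_mul_norm θ u
    have hn : ‖u‖ ≤ R := by
      rw [hR, le_div_iff₀ hl]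
      rcases (norm_nonneg u).eq_or_lt with h0 | h0
      · rw [← h0]; simp
      · refine le_of_mul_le_mul_right ?_ h0
        nlinarith
    refine ⟨by simpa using hn, Set.mem_iInter.mpr fun i => Set.mem_iInter.mpr fun j =>
      hmargin i j u hu ?_⟩
    have h4 := hH.dotProduct_mulVec_nonneg (WithLp.ofLp u)
    rw [star_trivial] at h4
    rw [le_div_iff₀ hμ]
    have h5 := mul_le_mul_of_nonneg_left hn (norm_nonneg θ)
    rw [objective] at hle
    linarith
  have h0K : (0 : EuclideanSpace ℝ (Fin n)) ∈ K :=
    hsub 0 C.zero_mem_domain (objective_zero θ).le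
  obtain ⟨u, huK, hmin⟩ := hKc.exists_isMinOn ⟨0, h0K⟩ fun u hu =>
    (continuousAt_objective (H := H) (μ := μ) θ (hKdom hu)).continuousWithinAt
  refine ⟨u, hKdom huK, isMinOn_iff.mpr fun v hv => ?_⟩
  rcases le_total (C.objective H μ θ v) 0 with h | h
  · exact isMinOn_iff.mp hmin v (hsub v hv h)
  · have := isMinOn_iff.mp hmin 0 h0K
    rw [objective_zero] at this
    exact this.trans h

/-- First order optimality. -/
theorem IsMPCSolution.stationary (hH : H.PosSemidef) {θ u : EuclideanSpace ℝ (Fin n)}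
    (h : C.IsMPCSolution H μ θ u) (d : EuclideanSpace ℝ (Fin n)) :
    WithLp.ofLp d ⬝ᵥ (H *ᵥ WithLp.ofLp u) + μ * C.barrierDeriv u d
      = WithLp.ofLp θ ⬝ᵥ WithLp.ofLp d := by
  have hsymm : WithLp.ofLp u ⬝ᵥ (H *ᵥ WithLp.ofLp d)
      = WithLp.ofLp d ⬝ᵥ (H *ᵥ WithLp.ofLp u) := by
    have hT : Hᵀ = H := by simpa [Matrix.IsHermitian] using hH.isHermitian
    rw [Matrix.dotProduct_mulVec, ← Matrix.mulVec_transpose, hT, dotProduct_comm]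
  have hmin : IsLocalMin (C.objective H μ θ) u := h.2.isLocalMin (C.isOpen_domain.mem_nhds h.1)
  have hline : Filter.Tendsto (fun t : ℝ => u + t • d) (𝓝 0) (𝓝 u) := by
    have : Continuous fun t : ℝ => u + t • d := by fun_prop
    simpa using this.tendsto 0
  have hmin' : IsLocalMin (fun t : ℝ => C.objective H μ θ (u + t • d)) 0 := by
    have : ∀ᶠ v in 𝓝 u, C.objective H μ θ u ≤ C.objective H μ θ v := hmin
    have h2 := hline.eventually this
    unfold IsLocalMin IsMinFilter
    simpa using h2
  -- On a line the objective is a quadratic polynomial in t plus the barrier, so a scalar derivative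
  -- suffices.
  have e : (fun t : ℝ => C.objective H μ θ (u + t • d)) = fun t : ℝ =>
      ((1 / 2) * (WithLp.ofLp u ⬝ᵥ (H *ᵥ WithLp.ofLp u)) - WithLp.ofLp θ ⬝ᵥ WithLp.ofLp u
      + t * (WithLp.ofLp d ⬝ᵥ (H *ᵥ WithLp.ofLp u) - WithLp.ofLp θ ⬝ᵥ WithLp.ofLp d)
      + t ^ 2 * ((1 / 2) * (WithLp.ofLp d ⬝ᵥ (H *ᵥ WithLp.ofLp d))))
      + μ * C.barrier (u + t • d) := by
    ext t
    rw [objective]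
    simp only [WithLp.ofLp_add, WithLp.ofLp_smul, Matrix.mulVec_add, Matrix.mulVec_smul,
      add_dotProduct, dotProduct_add, smul_dotProduct, dotProduct_smul, smul_eq_mul, hsymm]
    ring
  have hdom : u + (0 : ℝ) • d ∈ C.domain := by simpa using h.1
  have hder : HasDerivAt (fun t : ℝ => C.objective H μ θ (u + t • d))
      ((WithLp.ofLp d ⬝ᵥ (H *ᵥ WithLp.ofLp u) - WithLp.ofLp θ ⬝ᵥ WithLp.ofLp d)
        + μ * C.barrierDeriv u d) 0 := by
    rw [e]
    have h1 := (C.hasDerivAt_barrier_line hdom).const_mul μ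
    have h2 := ((hasDerivAt_id (0 : ℝ)).mul_const
      (WithLp.ofLp d ⬝ᵥ (H *ᵥ WithLp.ofLp u) - WithLp.ofLp θ ⬝ᵥ WithLp.ofLp d)).const_add
      ((1 / 2) * (WithLp.ofLp u ⬝ᵥ (H *ᵥ WithLp.ofLp u)) - WithLp.ofLp θ ⬝ᵥ WithLp.ofLp u)
    have h3 := (hasDerivAt_pow 2 (0 : ℝ)).mul_const
      ((1 / 2) * (WithLp.ofLp d ⬝ᵥ (H *ᵥ WithLp.ofLp d)))
    refine ((h2.add h3).add h1).congr_deriv ?_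
    simp
  have := hmin'.hasDerivAt_eq_zero hder
  linarith

/-- Sum of the two strong convexity inequalities obtained by exchanging the endpoints. -/
lemma HessianLowerBound.barrierDeriv_sub_le (hB : C.HessianLowerBound m)
    {u v : EuclideanSpace ℝ (Fin n)} (hu : u ∈ C.domain) (hv : v ∈ C.domain) :
    m * ‖v - u‖ ^ 2 ≤ C.barrierDeriv v (v - u) - C.barrierDeriv u (v - u) := by
  have h1 := hB.barrier_add_le (u := u) (d := v - u) hu (by simpa using hv)
  have h2 := hB.barrier_add_le (u := v) (d := u - v) hv (by simpa using hu)
  rw [add_sub_cancel] at h1 h2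
  rw [← neg_sub v u, map_neg, norm_neg] at h2
  linarith

/-- Strong monotonicity of the inverse of the barrier MPC map. -/
theorem IsMPCSolution.strong_monotone (hμ : 0 < μ) (hB : C.HessianLowerBound m)
    (hH : H.PosSemidef) {θ θ' u u' : EuclideanSpace ℝ (Fin n)}
    (h : C.IsMPCSolution H μ θ u) (h' : C.IsMPCSolution H μ θ' u') :
    WithLp.ofLp (u - u') ⬝ᵥ (slopeMatrix H μ m *ᵥ WithLp.ofLp (u - u'))
      ≤ WithLp.ofLp (θ - θ') ⬝ᵥ WithLp.ofLp (u - u') := by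
  have h1 := h.stationary hH (u - u')
  have h2 := h'.stationary hH (u - u')
  have h3 := mul_le_mul_of_nonneg_left (hB.barrierDeriv_sub_le h'.1 h.1) hμ.le
  rw [norm_sq_eq_dotProduct] at h3
  rw [dotProduct_slopeMatrix]
  simp only [WithLp.ofLp_sub, Matrix.mulVec_sub, sub_dotProduct, dotProduct_sub] at *
  linarith

/-- Strong monotonicity with Cauchy–Schwarz. Equal parameters give uniqueness; comparison with the
solution at θ = 0 gives the ℓ₂ bound. -/
theorem IsMPCSolution.norm_sub_le (hμ : 0 < μ) (hB : C.HessianLowerBound m)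
    (hH : H.PosSemidef) {l : ℝ} (hl : 0 < l) (hcoer : ∀ u : EuclideanSpace ℝ (Fin n),
      l * ‖u‖ ^ 2 ≤ WithLp.ofLp u ⬝ᵥ (slopeMatrix H μ m *ᵥ WithLp.ofLp u))
    {θ θ' u u' : EuclideanSpace ℝ (Fin n)}
    (h : C.IsMPCSolution H μ θ u) (h' : C.IsMPCSolution H μ θ' u') :
    ‖u - u'‖ ≤ ‖θ - θ'‖ / l := by
  have h1 := h.strong_monotone hμ hB hH h'
  have h2 := hcoer (u - u')
  have h3 := dotProduct_le_norm_mul_norm (θ - θ') (u - u')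
  rw [le_div_iff₀ hl]
  rcases (norm_nonneg (u - u')).eq_or_lt with h0 | h0
  · rw [← h0]; simp
  · refine le_of_mul_le_mul_right ?_ h0
    nlinarith

lemma isMPCSolution_zero (hμ : 0 < μ) (hB : C.HessianLowerBound m)
    (hHt : (slopeMatrix H μ m).PosDef) : C.IsMPCSolution H μ 0 0 := by
  refine ⟨C.zero_mem_domain, isMinOn_iff.mpr fun u hu => ?_⟩
  have h1 := le_objective (H := H) hμ hB 0 hu
  have h2 := hHt.posSemidef.dotProduct_mulVec_nonneg (WithLp.ofLp u)
  rw [star_trivial] at h2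
  rw [objective_zero]
  simp only [WithLp.ofLp_zero, zero_dotProduct] at h1
  linarith

theorem isMPCSolution_iff (hμ : 0 < μ) (hB : C.HessianLowerBound m)
    (hH : H.PosSemidef) (hHt : (slopeMatrix H μ m).PosDef) (θ u : EuclideanSpace ℝ (Fin n)) :
    C.IsMPCSolution H μ θ u ↔ u = C.mpcMap H μ θ := by
  obtain ⟨l, hl, hcoer⟩ := hHt.exists_coercive
  have hsol : C.IsMPCSolution H μ θ (C.mpcMap H μ θ) :=
    Classical.epsilon_spec (exists_isMPCSolution hμ hB hH hHt θ)
  refine ⟨fun h => ?_, fun h => h ▸ hsol⟩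
  have := h.norm_sub_le hμ hB hH hl hcoer hsol
  rw [sub_self, norm_zero, zero_div] at this
  exact sub_eq_zero.mp (norm_le_zero_iff.mp this)

end BarrierConstraints

/-! ### Splitting along the orthogonal row spaces. -/

lemma Matrix.exists_eq_mul_of_span_le {ι κ l : Type*} [Fintype κ] {X : Matrix ι l ℝ}
    {Y : Matrix κ l ℝ}
    (h : Submodule.span ℝ (Set.range fun a => X a) ≤ Submodule.span ℝ (Set.range fun a => Y a)) :
    ∃ A : Matrix ι κ ℝ, X = A * Y := by
  have hx : ∀ a, ∃ c : κ → ℝ, ∑ b, c b • Y b = X a := fun a =>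
    (Submodule.mem_span_range_iff_exists_fun ℝ).mp (h (Submodule.subset_span ⟨a, rfl⟩))
  choose A hA using hx
  refine ⟨Matrix.of A, ?_⟩
  ext a k
  rw [← hA a]
  simp [Matrix.mul_apply]

namespace BarrierConstraints

variable {n N : ℕ} {C : BarrierConstraints n N} {H : Matrix (Fin n) (Fin n) ℝ} {μ m : ℝ}
  {ρ : Fin N → ℕ} {Lb : (i : Fin N) → Matrix (Fin (ρ i)) (Fin n) ℝ}

lemma IsOrthonormalRowBasis.exists_mul_eq (hLb : C.IsOrthonormalRowBasis Lb) (i : Fin N) :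
    ∃ A : Matrix (Fin (ρ i)) (Fin (C.r i)) ℝ, Lb i = A * C.L i :=
  Matrix.exists_eq_mul_of_span_le (hLb i).2.le

lemma IsOrthonormalRowBasis.mul_projection (hLb : C.IsOrthonormalRowBasis Lb) (i : Fin N) :
    C.L i * ((Lb i)ᵀ * Lb i) = C.L i := by
  obtain ⟨A, hA⟩ := Matrix.exists_eq_mul_of_span_le (hLb i).2.ge
  rw [hA, Matrix.mul_assoc, ← Matrix.mul_assoc (Lb i), (hLb i).1, Matrix.one_mul]

lemma IsOrthonormalRowBasis.mul_transpose_eq_zero (hLb : C.IsOrthonormalRowBasis Lb)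
    (horth : C.OrthogonalRows) {i k : Fin N} (h : k ≠ i) : C.L k * (Lb i)ᵀ = 0 := by
  obtain ⟨A, hA⟩ := hLb.exists_mul_eq i
  rw [hA, Matrix.transpose_mul, ← Matrix.mul_assoc, horth k i h, Matrix.zero_mul]

/-- Orthogonal projection onto the row space of `Lb i`. -/
def rowProj (Lb : (i : Fin N) → Matrix (Fin (ρ i)) (Fin n) ℝ) (i : Fin N)
    (d : EuclideanSpace ℝ (Fin n)) : EuclideanSpace ℝ (Fin n) :=
  WithLp.toLp 2 (((Lb i)ᵀ * Lb i) *ᵥ WithLp.ofLp d)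

lemma row_rowProj_same (hLb : C.IsOrthonormalRowBasis Lb) (i : Fin N) (j : Fin (C.r i))
    (d : EuclideanSpace ℝ (Fin n)) : C.row i j (rowProj Lb i d) = C.row i j d := by
  rw [row_apply, row_apply, rowProj, Matrix.mulVec_mulVec, hLb.mul_projection]

lemma row_rowProj_of_ne (hLb : C.IsOrthonormalRowBasis Lb) (horth : C.OrthogonalRows)
    {i k : Fin N} (h : k ≠ i) (j : Fin (C.r k)) (d : EuclideanSpace ℝ (Fin n)) :
    C.row k j (rowProj Lb i d) = 0 := by
  rw [row_apply, rowProj, Matrix.mulVec_mulVec, ← Matrix.mul_assoc,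
    hLb.mul_transpose_eq_zero horth h, Matrix.zero_mul, Matrix.zero_mulVec]
  rfl

lemma rowProj_dotProduct (i : Fin N) (d : EuclideanSpace ℝ (Fin n)) (w : Fin n → ℝ) :
    WithLp.ofLp (rowProj Lb i d) ⬝ᵥ w = (Lb i *ᵥ WithLp.ofLp d) ⬝ᵥ (Lb i *ᵥ w) := by
  rw [rowProj, ← Matrix.mulVec_mulVec, Matrix.mulVec_transpose, ← Matrix.dotProduct_mulVec]

lemma norm_rowProj_sq (hLb : C.IsOrthonormalRowBasis Lb) (i : Fin N)
    (d : EuclideanSpace ℝ (Fin n)) :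
    ‖rowProj Lb i d‖ ^ 2 = (Lb i *ᵥ WithLp.ofLp d) ⬝ᵥ (Lb i *ᵥ WithLp.ofLp d) := by
  rw [norm_sq_eq_dotProduct, rowProj_dotProduct, rowProj, Matrix.mulVec_mulVec,
    ← Matrix.mul_assoc, (hLb i).1, Matrix.one_mul]

/-- The step gives the rows of group i their values at v and leaves all other rows at their values
at u. -/
lemma add_rowProj_mem_domain (hLb : C.IsOrthonormalRowBasis Lb) (horth : C.OrthogonalRows)
    (i : Fin N) {u v : EuclideanSpace ℝ (Fin n)} (hu : u ∈ C.domain) (hv : v ∈ C.domain) :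
    u + rowProj Lb i (v - u) ∈ C.domain := by
  refine mem_domain.mpr fun k j h0 => ?_
  rw [map_add]
  rcases eq_or_ne k i with rfl | hk
  · rw [row_rowProj_same hLb, map_sub, add_sub_cancel]
    exact hv k j h0
  · rw [row_rowProj_of_ne hLb horth hk, add_zero]
    exact hu k j h0

/-- The part of the barrier that belongs to the rows of `L_i`. -/
def groupBarrier (C : BarrierConstraints n N) (i : Fin N) (u : EuclideanSpace ℝ (Fin n)) : ℝ :=
  ∑ j, C.term i j (C.row i j u)

lemma barrier_add_rowProj (hLb : C.IsOrthonormalRowBasis Lb) (horth : C.OrthogonalRows)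
    (i : Fin N) (u v : EuclideanSpace ℝ (Fin n)) :
    C.barrier (u + rowProj Lb i (v - u)) - C.barrier u
      = C.groupBarrier i v - C.groupBarrier i u := by
  rw [barrier_eq, barrier_eq, ← Finset.sum_sub_distrib, Finset.sum_eq_single i]
  · simp_rw [map_add, row_rowProj_same hLb, map_sub, add_sub_cancel]
    rfl
  · intro k _ hk
    simp_rw [map_add, row_rowProj_of_ne hLb horth hk, add_zero, sub_self]
  · simp

/-- The potential whose gradient is the `i`-th block of the shifted inverse of the MPC map. -/
def groupPotential (C : BarrierConstraints n N) (μ m : ℝ)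
    (Lb : (i : Fin N) → Matrix (Fin (ρ i)) (Fin n) ℝ) (i : Fin N)
    (u : EuclideanSpace ℝ (Fin n)) : ℝ :=
  μ * (C.groupBarrier i u
    - m / 2 * ((Lb i *ᵥ WithLp.ofLp u) ⬝ᵥ (Lb i *ᵥ WithLp.ofLp u)))

/-- Subgradient inequality for the group potentials. -/
theorem IsMPCSolution.groupPotential_le (hμ : 0 < μ) (hB : C.HessianLowerBound m)
    (hH : H.PosSemidef) (hLb : C.IsOrthonormalRowBasis Lb) (horth : C.OrthogonalRows)
    (i : Fin N) {θ u v : EuclideanSpace ℝ (Fin n)} (h : C.IsMPCSolution H μ θ u)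
    (hv : v ∈ C.domain) :
    C.groupPotential μ m Lb i u + (Lb i *ᵥ WithLp.ofLp v - Lb i *ᵥ WithLp.ofLp u) ⬝ᵥ
      (Lb i *ᵥ (WithLp.ofLp θ - slopeMatrix H μ m *ᵥ WithLp.ofLp u))
      ≤ C.groupPotential μ m Lb i v := by
  -- Strong convexity of the whole barrier is used in the projected direction only, and stationarity
  -- in that direction eliminates its derivative. The remaining squares complete to the m-terms of
  -- the potentials.
  have h1 := mul_le_mul_of_nonneg_left
    (hB.barrier_add_le h.1 (add_rowProj_mem_domain hLb horth i h.1 hv)) hμ.le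
  have h2 := barrier_add_rowProj hLb horth i u v
  have h3 := h.stationary hH (rowProj Lb i (v - u))
  have h4 := norm_rowProj_sq hLb i (v - u)
  have h5 := rowProj_dotProduct (Lb := Lb) i (v - u) (WithLp.ofLp u)
  have h6 := rowProj_dotProduct (Lb := Lb) i (v - u)
    (WithLp.ofLp θ - slopeMatrix H μ m *ᵥ WithLp.ofLp u)
  have h7 : C.barrier (u + rowProj Lb i (v - u))
      = C.barrier u + (C.groupBarrier i v - C.groupBarrier i u) := by linarith
  rw [dotProduct_sub, dotProduct_slopeMatrix, h5] at h6
  rw [h4, h7] at h1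
  rw [dotProduct_comm] at h3
  simp only [WithLp.ofLp_sub, Matrix.mulVec_sub] at *
  have h8 := dotProduct_comm (Lb i *ᵥ WithLp.ofLp u) (Lb i *ᵥ WithLp.ofLp v)
  have h9 := dotProduct_comm (WithLp.ofLp θ) (WithLp.ofLp (rowProj Lb i (v - u)))
  have h10 := dotProduct_comm (WithLp.ofLp (rowProj Lb i (v - u))) (H *ᵥ WithLp.ofLp u)
  rw [← h6]
  unfold groupPotential
  simp only [sub_dotProduct, dotProduct_sub] at *
  rw [h8] at *
  linarith

lemma groupPotential_zero (i : Fin N) : C.groupPotential μ m Lb i 0 = 0 := by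
  simp [groupPotential, groupBarrier, term_zero]

/-- A nonzero common kernel vector would span a line inside the polyhedron, contradicting
boundedness. -/
lemma eq_zero_of_mulVec_eq_zero (hcompact : IsCompact C.feasible) {w : Fin n → ℝ}
    (hw : ∀ i, C.L i *ᵥ w = 0) : w = 0 := by
  by_contra hne
  have hn : 0 < ‖(WithLp.toLp 2 w : EuclideanSpace ℝ (Fin n))‖ := by
    rw [norm_pos_iff]
    intro h
    exact hne (congrArg WithLp.ofLp h)
  obtain ⟨R, hR⟩ := hcompact.isBounded.exists_norm_le
  have hmem : ∀ t : ℝ, t • (WithLp.toLp 2 w : EuclideanSpace ℝ (Fin n)) ∈ C.feasible := by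
    intro t i j
    rw [WithLp.ofLp_smul, Matrix.mulVec_smul, hw i, smul_zero]
    exact (C.W_pos i j).le
  -- The multiple is chosen to have norm |R| + 1.
  have := hR _ (hmem ((|R| + 1) / ‖(WithLp.toLp 2 w : EuclideanSpace ℝ (Fin n))‖))
  rw [norm_smul, norm_div, norm_norm, div_mul_cancel₀ _ hn.ne', Real.norm_of_nonneg
    (by positivity)] at this
  linarith [le_abs_self R]

/-- Every L_k annihilates I - Σ L̄_iᵀL̄_i, so its columns lie in the trivial common kernel. -/
lemma IsOrthonormalRowBasis.sum_projection (hLb : C.IsOrthonormalRowBasis Lb)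
    (horth : C.OrthogonalRows) (hcompact : IsCompact C.feasible) :
    ∑ i, (Lb i)ᵀ * Lb i = 1 := by
  refine (sub_eq_zero.mp (Matrix.ext_of_mulVec_single fun a => ?_)).symm
  rw [Matrix.zero_mulVec]
  refine eq_zero_of_mulVec_eq_zero hcompact fun k => ?_
  rw [Matrix.mulVec_mulVec, Matrix.mul_sub, Matrix.mul_one, Matrix.mul_sum,
    Finset.sum_eq_single k, hLb.mul_projection, sub_self, Matrix.zero_mulVec]
  · intro i _ hi
    rw [← Matrix.mul_assoc, hLb.mul_transpose_eq_zero horth hi.symm, Matrix.zero_mul]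
  · simp

/-- Row k of the i-th projection vanishes unless k lies in block i. As the projections sum to I, the
one surviving contribution is row k of the identity. -/
lemma IsOrthonormalRowBasis.projection_eq_diagonal (hLb : C.IsOrthonormalRowBasis Lb)
    (horth : C.OrthogonalRows) (hcompact : IsCompact C.feasible) {blk : Fin n → Fin N}
    (hblk : C.BlockDiagonal blk) (i : Fin N) :
    (Lb i)ᵀ * Lb i = Matrix.diagonal fun k => if blk k = i then 1 else 0 := by
  have hzero : ∀ i a k, blk k ≠ i → Lb i a k = 0 := by
    intro i a k hk
    obtain ⟨A, hA⟩ := hLb.exists_mul_eq i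
    rw [hA, Matrix.mul_apply]
    exact Finset.sum_eq_zero fun j _ => by rw [hblk i j k hk, mul_zero]
  have hP : ∀ i k l, blk k ≠ i → ((Lb i)ᵀ * Lb i) k l = 0 := by
    intro i k l hk
    rw [Matrix.mul_apply]
    exact Finset.sum_eq_zero fun a _ => by rw [Matrix.transpose_apply, hzero i a k hk, zero_mul]
  ext k l
  by_cases hk : blk k = i
  · have h1 := congrFun (congrFun (hLb.sum_projection horth hcompact) k) l
    rw [Matrix.sum_apply, Finset.sum_eq_single i
      (fun i' _ hi' => hP i' k l fun h => hi' (h.symm.trans hk)) (by simp)] at h1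
    rw [h1, Matrix.diagonal_apply, Matrix.one_apply, if_pos hk]
  · rw [hP i k l hk, Matrix.diagonal_apply, if_neg hk, ite_self]

variable (C) in
-- Needed because the staged multiplier mentions no basis, while its IQC is deduced from the version
-- that does.
lemma exists_isOrthonormalRowBasis :
    ∃ (ρ : Fin N → ℕ) (Lb : (i : Fin N) → Matrix (Fin (ρ i)) (Fin n) ℝ),
      C.IsOrthonormalRowBasis Lb := by
  let S : Fin N → Submodule ℝ (EuclideanSpace ℝ (Fin n)) := fun i =>
    Submodule.span ℝ (Set.range fun j => (WithLp.toLp 2 (C.L i j) : EuclideanSpace ℝ (Fin n)))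
  let b := fun i => stdOrthonormalBasis ℝ (S i)
  let e : EuclideanSpace ℝ (Fin n) →ₗ[ℝ] (Fin n → ℝ) :=
    (WithLp.linearEquiv 2 ℝ (Fin n → ℝ)).toLinearMap
  refine ⟨_, fun i => Matrix.of fun a => WithLp.ofLp (b i a : EuclideanSpace ℝ (Fin n)),
    fun i => ⟨?_, ?_⟩⟩
  · ext a a'
    have := orthonormal_iff_ite.mp (b i).orthonormal a' a
    rw [Submodule.coe_inner, EuclideanSpace.inner_eq_star_dotProduct, star_trivial] at this
    rw [Matrix.one_apply]
    simp_rw [eq_comm (a := a) (b := a')]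
    exact this
  · have h1 : Submodule.span ℝ (Set.range fun a => (b i a : EuclideanSpace ℝ (Fin n))) = S i := by
      have h := congrArg (Submodule.map (S i).subtype) (b i).toBasis.span_eq
      rw [Submodule.map_span, Submodule.map_subtype_top, ← Set.range_comp] at h
      simpa [Function.comp_def] using h
    have h2 := congrArg (Submodule.map e) h1
    rw [Submodule.map_span, Submodule.map_span, ← Set.range_comp, ← Set.range_comp] at h2
    exact h2

end BarrierConstraints

/-! ### Algebra and regularity of the multipliers. -/

lemma toComplex_conjTranspose {ι κ : Type*} (A : Matrix ι κ ℝ) :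
    (toComplex A)ᴴ = (toComplex A)ᵀ := by
  ext a b
  simp [toComplex]

lemma toComplex_mul {ι κ l : Type*} [Fintype κ] (A : Matrix ι κ ℝ) (B : Matrix κ l ℝ) :
    toComplex (A * B) = toComplex A * toComplex B :=
  Matrix.map_mul

lemma toComplex_transpose {ι κ : Type*} (A : Matrix ι κ ℝ) :
    toComplex Aᵀ = (toComplex A)ᵀ := rfl

lemma conjTranspose_loopTransform {n : ℕ} (A : Matrix (Fin n) (Fin n) ℝ) :
    (loopTransform A)ᴴ = (loopTransform A)ᵀ := by
  rw [loopTransform, Matrix.fromBlocks_conjTranspose, Matrix.fromBlocks_transpose]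
  simp [toComplex_conjTranspose]

/-- The transformed parallel multiplier. -/
def loopMultiplier {n N : ℕ} {ρ : Fin N → ℕ} (A : Matrix (Fin n) (Fin n) ℝ)
    (Lb : (i : Fin N) → Matrix (Fin (ρ i)) (Fin n) ℝ) (M : Fin N → RatFunc ℝ) (z : ℂ) :
    Matrix (Fin n ⊕ Fin n) (Fin n ⊕ Fin n) ℂ :=
  (loopTransform A)ᵀ * parallelMultiplier Lb M z * loopTransform A

lemma isHermitian_unitSlopeMultiplier (p : ℕ) (M : RatFunc ℝ) (z : ℂ) :
    (unitSlopeMultiplier p M z).IsHermitian := by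
  rw [Matrix.IsHermitian, unitSlopeMultiplier, Matrix.fromBlocks_conjTranspose]
  simp only [Matrix.conjTranspose_zero, Matrix.conjTranspose_smul, Matrix.conjTranspose_one,
    Matrix.conjTranspose_sub, Matrix.conjTranspose_neg, star_star]
  congr 1
  abel

lemma isHermitian_loopMultiplier {n N : ℕ} {ρ : Fin N → ℕ} (A : Matrix (Fin n) (Fin n) ℝ)
    (Lb : (i : Fin N) → Matrix (Fin (ρ i)) (Fin n) ℝ) (M : Fin N → RatFunc ℝ) (z : ℂ) :
    (loopMultiplier A Lb M z).IsHermitian := by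
  rw [loopMultiplier, ← conjTranspose_loopTransform]
  refine Matrix.isHermitian_conjTranspose_mul_mul _ ?_
  unfold parallelMultiplier
  rw [Matrix.IsHermitian, Matrix.conjTranspose_sum]
  refine Finset.sum_congr rfl fun i _ => ?_
  have hD : (Matrix.fromBlocks (toComplex (Lb i)) 0 0 (toComplex (Lb i)))ᵀ
      = (Matrix.fromBlocks (toComplex (Lb i)) 0 0 (toComplex (Lb i)))ᴴ := by
    rw [Matrix.fromBlocks_conjTranspose, Matrix.fromBlocks_transpose]
    simp [toComplex_conjTranspose]
  rw [hD]
  exact Matrix.isHermitian_conjTranspose_mul_mul _ (isHermitian_unitSlopeMultiplier _ _ _)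

/-- Absence of poles on the circle gives continuity; measurability and, by compactness, boundedness
of the multiplier follow from it. -/
lemma IsZamesFalbPlus.continuous_transferEval {M : RatFunc ℝ} (hM : IsZamesFalbPlus M) :
    Continuous fun z : Metric.sphere (0 : ℂ) 1 => transferEval M z := by
  have hp : ∀ p : Polynomial ℝ, Continuous fun z : Metric.sphere (0 : ℂ) 1 =>
      p.eval₂ (algebraMap ℝ ℂ) z := fun p => by
    simp_rw [Polynomial.eval₂_eq_eval_map]
    exact (Polynomial.continuous _).comp continuous_subtype_val
  exact (hp _).div (hp _) fun z => hM.1 z (by simp)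

lemma continuous_loopMultiplier {n N : ℕ} {ρ : Fin N → ℕ} (A : Matrix (Fin n) (Fin n) ℝ)
    (Lb : (i : Fin N) → Matrix (Fin (ρ i)) (Fin n) ℝ) {M : Fin N → RatFunc ℝ}
    (hM : ∀ i, IsZamesFalbPlus (M i)) :
    Continuous fun z : Metric.sphere (0 : ℂ) 1 => loopMultiplier A Lb M z := by
  refine (continuous_const.matrix_mul ?_).matrix_mul continuous_const
  refine continuous_finsetSum _ fun i _ => ?_
  refine (continuous_const.matrix_mul ?_).matrix_mul continuous_const
  have h := (hM i).continuous_transferEval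
  have h1 : Continuous fun z : Metric.sphere (0 : ℂ) 1 =>
      transferEval (M i) z • (1 : Matrix (Fin (ρ i)) (Fin (ρ i)) ℂ) := h.smul continuous_const
  have h2 : Continuous fun z : Metric.sphere (0 : ℂ) 1 =>
      star (transferEval (M i) z) • (1 : Matrix (Fin (ρ i)) (Fin (ρ i)) ℂ) :=
    h.star.smul continuous_const
  exact Continuous.matrix_fromBlocks continuous_const h2 h1 (h1.neg.sub h2)

lemma isIQCMultiplier_loopMultiplier {n N : ℕ} {ρ : Fin N → ℕ} (A : Matrix (Fin n) (Fin n) ℝ)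
    (Lb : (i : Fin N) → Matrix (Fin (ρ i)) (Fin n) ℝ) {M : Fin N → RatFunc ℝ}
    (hM : ∀ i, IsZamesFalbPlus (M i)) : IsIQCMultiplier (loopMultiplier A Lb M) where
  measurable a b := by
    have he : Continuous fun ω : ℝ =>
        (⟨Complex.exp (ω * Complex.I), by simp [Complex.norm_exp_ofReal_mul_I]⟩ :
          Metric.sphere (0 : ℂ) 1) := by
      refine Continuous.subtype_mk ?_ _
      fun_prop
    exact (((continuous_loopMultiplier A Lb hM).comp he).matrix_elem a b).measurable
  bounded := by
    have hb : ∀ a b, ∃ K : ℝ, ∀ z : Metric.sphere (0 : ℂ) 1, ‖loopMultiplier A Lb M z a b‖ ≤ K := by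
      intro a b
      obtain ⟨K, hK⟩ := isCompact_univ.exists_bound_of_continuousOn
        ((continuous_loopMultiplier A Lb hM).matrix_elem a b).continuousOn
      exact ⟨K, fun z => hK z (Set.mem_univ z)⟩
    choose K hK using hb
    refine ⟨∑ a, ∑ b, |K a b|, fun z hz a b => ?_⟩
    calc ‖loopMultiplier A Lb M z a b‖ ≤ |K a b| :=
          (hK a b ⟨z, by simpa using hz⟩).trans (le_abs_self _)
      _ ≤ ∑ b, |K a b| := Finset.single_le_sum (f := fun b => |K a b|)
          (fun _ _ => abs_nonneg _) (Finset.mem_univ b)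
      _ ≤ ∑ a, ∑ b, |K a b| := Finset.single_le_sum (f := fun a => ∑ b, |K a b|)
          (fun _ _ => Finset.sum_nonneg fun _ _ => abs_nonneg _) (Finset.mem_univ a)
  hermitian z _ := isHermitian_loopMultiplier A Lb M z

/-- For box and staged constraints the transformed parallel multiplier has a closed form. -/
theorem BarrierConstraints.IsOrthonormalRowBasis.loopMultiplier_eq_stagedMultiplier {n N : ℕ}
    {C : BarrierConstraints n N} {ρ : Fin N → ℕ}
    {Lb : (i : Fin N) → Matrix (Fin (ρ i)) (Fin n) ℝ} (hLb : C.IsOrthonormalRowBasis Lb)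
    (horth : C.OrthogonalRows) (hcompact : IsCompact C.feasible) {blk : Fin n → Fin N}
    (hblk : C.BlockDiagonal blk) {A : Matrix (Fin n) (Fin n) ℝ} (hA : Aᵀ = A)
    (M : Fin N → RatFunc ℝ) (z : ℂ) :
    loopMultiplier A Lb M z = stagedMultiplier A blk M z := by
  have hP : ∀ i, (toComplex (Lb i))ᵀ * toComplex (Lb i)
      = Matrix.diagonal fun k => if blk k = i then 1 else 0 := by
    intro i
    rw [← toComplex_transpose, ← toComplex_mul,
      hLb.projection_eq_diagonal horth hcompact hblk i, toComplex,
      Matrix.diagonal_map (map_zero _)]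
    congr 1
    ext k
    split_ifs <;> simp
  have hpar : parallelMultiplier Lb M z = Matrix.fromBlocks 0 (blockMultiplier blk M z)ᴴ
      (blockMultiplier blk M z) (-blockMultiplier blk M z - (blockMultiplier blk M z)ᴴ) := by
    have hi : ∀ i, (Matrix.fromBlocks (toComplex (Lb i)) 0 0 (toComplex (Lb i)))ᵀ
        * unitSlopeMultiplier (ρ i) (M i) z
        * Matrix.fromBlocks (toComplex (Lb i)) 0 0 (toComplex (Lb i))
        = Matrix.fromBlocks 0
          (star (transferEval (M i) z) • Matrix.diagonal fun k => if blk k = i then (1 : ℂ) else 0)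
          (transferEval (M i) z • Matrix.diagonal fun k => if blk k = i then (1 : ℂ) else 0)
          (-(transferEval (M i) z • Matrix.diagonal fun k => if blk k = i then (1 : ℂ) else 0)
            - star (transferEval (M i) z)
              • Matrix.diagonal fun k => if blk k = i then (1 : ℂ) else 0) := by
      intro i
      rw [Matrix.fromBlocks_transpose, unitSlopeMultiplier, Matrix.fromBlocks_multiply,
        Matrix.fromBlocks_multiply, ← hP i]
      simp [Matrix.mul_sub, Matrix.sub_mul]
    have hsum : ∀ (f : Fin N → ℂ),
        ∑ i, f i • Matrix.diagonal (fun k => if blk k = i then (1 : ℂ) else 0)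
          = Matrix.diagonal fun k => f (blk k) := by
      intro f
      ext k l
      rw [Matrix.sum_apply]
      by_cases hkl : k = l
      · subst hkl
        simp
      · simp [Matrix.diagonal_apply_ne _ hkl]
    have hstar : (blockMultiplier blk M z)ᴴ
        = ∑ i, star (transferEval (M i) z)
          • Matrix.diagonal fun k => if blk k = i then (1 : ℂ) else 0 := by
      rw [hsum, blockMultiplier, Matrix.diagonal_conjTranspose]
      rfl
    rw [hstar, blockMultiplier, ← hsum fun i => transferEval (M i) z, parallelMultiplier,
      Finset.sum_congr rfl fun i _ => hi i]
    ext (k | k) (l | l) <;>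
      simp [Matrix.sum_apply, Finset.sum_sub_distrib]
  have hAc : (toComplex A)ᵀ = toComplex A := by rw [← toComplex_transpose, hA]
  -- In the lower right block, M(I - A) + (I - A)M^* - M - M^* collapses to -MA - AM^*.
  rw [loopMultiplier, hpar, stagedMultiplier, loopTransform, Matrix.fromBlocks_transpose,
    Matrix.fromBlocks_multiply, Matrix.fromBlocks_multiply]
  simp only [Matrix.transpose_one, Matrix.transpose_zero, Matrix.transpose_sub, hAc,
    Matrix.one_mul, Matrix.mul_one, Matrix.zero_mul, Matrix.mul_zero, add_zero, zero_add,
    Matrix.mul_sub, Matrix.sub_mul, Matrix.mul_neg]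
  congr 1 <;> abel

/-! ### From signals to the quadratic form of the multiplier. -/

lemma memℓp_two_of_norm_le {E F : Type*} [NormedAddCommGroup E] [NormedAddCommGroup F]
    {x : ℤ → E} {y : ℤ → F} (hx : Memℓp x 2) (K : ℝ) (h : ∀ k, ‖y k‖ ≤ K * ‖x k‖) :
    Memℓp y 2 := by
  rw [memℓp_gen_iff (by norm_num)] at hx ⊢
  refine Summable.of_nonneg_of_le (fun k => by positivity) (fun k => ?_) (hx.mul_left (K ^ 2))
  simp only [ENNReal.toReal_ofNat, Real.rpow_ofNat]
  rw [← mul_pow]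
  exact pow_le_pow_left₀ (norm_nonneg _) (h k) 2

lemma memℓp_coord {n : ℕ} {x : ℤ → EuclideanSpace ℝ (Fin n)} (hx : Memℓp x 2) (a : Fin n) :
    Memℓp (fun k => x k a) 2 :=
  memℓp_two_of_norm_le hx 1 fun k => by
    rw [one_mul]
    exact PiLp.norm_apply_le (x k) a

/-- The stacked time domain signal. -/
def stack {n : ℕ} (w v : ℤ → EuclideanSpace ℝ (Fin n)) (k : ℤ) : Fin n ⊕ Fin n → ℝ :=
  Sum.elim (WithLp.ofLp (w k)) (WithLp.ofLp (v k))

section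

variable {n p : ℕ} {w v : ℤ → EuclideanSpace ℝ (Fin n)}

lemma memℓp_stack (hw : Memℓp w 2) (hv : Memℓp v 2) (s : Fin n ⊕ Fin n) :
    Memℓp (fun k => stack w v k s) 2 := by
  cases s with
  | inl a => exact memℓp_coord hw a
  | inr a => exact memℓp_coord hv a

lemma freqStack_apply (ω : ℝ) (s : Fin n ⊕ Fin n) :
    freqStack w v ω s = dtft (fun k => stack w v k s) ω := by
  cases s <;> rfl

lemma memℓp_mulVec_stack (hw : Memℓp w 2) (hv : Memℓp v 2)
    (A : Matrix (Fin p) (Fin n ⊕ Fin n) ℝ) (a : Fin p) :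
    Memℓp (fun k => (A *ᵥ stack w v k) a) 2 :=
  memℓp_finset_sum Finset.univ (A a) (memℓp_stack hw hv)

lemma dtft_mulVec_stack_ae (hw : Memℓp w 2) (hv : Memℓp v 2)
    (A : Matrix (Fin p) (Fin n ⊕ Fin n) ℝ) :
    ∀ᵐ ω : ℝ ∂(volume.restrict (Set.Ioc (-Real.pi) Real.pi)), ∀ a,
      dtft (fun k => (A *ᵥ stack w v k) a) ω = (toComplex A *ᵥ freqStack w v ω) a := by
  refine ae_all_iff.mpr fun a => ?_
  filter_upwards [dtft_sum_ae Finset.univ (A a) (memℓp_stack hw hv)] with ω h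
  simp only [Matrix.mulVec, dotProduct, freqStack_apply]
  exact h

end

/-- The quadratic form of the elementary Zames–Falb multiplier. -/
lemma unitSlopeMultiplier_quadratic {p : ℕ} (M : RatFunc ℝ) (z : ℂ) (η γ : Fin p → ℂ) :
    star (Sum.elim (γ + η) η) ⬝ᵥ (unitSlopeMultiplier p M z *ᵥ Sum.elim (γ + η) η)
      = (∑ a, star (η a) * (transferEval M z * γ a))
        + star (∑ a, star (η a) * (transferEval M z * γ a)) := by
  have hs : star (Sum.elim (γ + η) η) = Sum.elim (star γ + star η) (star η) := by
    ext (a | a) <;> simp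
  rw [hs, unitSlopeMultiplier, Matrix.fromBlocks_mulVec, star_sum, ← Finset.sum_add_distrib]
  simp only [Sum.elim_comp_inl, Sum.elim_comp_inr, sumElim_dotProduct_sumElim,
    Matrix.zero_mulVec, zero_add, Matrix.smul_mulVec, Matrix.one_mulVec, Matrix.sub_mulVec,
    Matrix.neg_mulVec]
  simp only [dotProduct]
  rw [← Finset.sum_add_distrib]
  refine Finset.sum_congr rfl fun a _ => ?_
  simp only [Pi.add_apply, Pi.smul_apply, Pi.star_apply, Pi.sub_apply, Pi.neg_apply, smul_eq_mul,
    star_mul, star_star]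
  ring

/-- Extracts the `i`-th block of the output. -/
def outputBlock {n p : ℕ} (L : Matrix (Fin p) (Fin n) ℝ) : Matrix (Fin p) (Fin n ⊕ Fin n) ℝ :=
  Matrix.fromCols 0 L

/-- Extracts the `i`-th block of `θ - A u` from the stack of `θ` and `u`. -/
def gradientBlock {n p : ℕ} (A : Matrix (Fin n) (Fin n) ℝ) (L : Matrix (Fin p) (Fin n) ℝ) :
    Matrix (Fin p) (Fin n ⊕ Fin n) ℝ :=
  Matrix.fromCols L (-(L * A))

lemma outputBlock_mulVec_stack {n p : ℕ} (L : Matrix (Fin p) (Fin n) ℝ)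
    (w v : ℤ → EuclideanSpace ℝ (Fin n)) (k : ℤ) :
    outputBlock L *ᵥ stack w v k = L *ᵥ WithLp.ofLp (v k) := by
  rw [outputBlock, stack, Matrix.fromCols_mulVec_sumElim, Matrix.zero_mulVec, zero_add]

lemma gradientBlock_mulVec_stack {n p : ℕ} (A : Matrix (Fin n) (Fin n) ℝ)
    (L : Matrix (Fin p) (Fin n) ℝ) (w v : ℤ → EuclideanSpace ℝ (Fin n)) (k : ℤ) :
    gradientBlock A L *ᵥ stack w v k
      = L *ᵥ (WithLp.ofLp (w k) - A *ᵥ WithLp.ofLp (v k)) := by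
  rw [gradientBlock, stack, Matrix.fromCols_mulVec_sumElim, Matrix.neg_mulVec, Matrix.mulVec_sub,
    Matrix.mulVec_mulVec, sub_eq_add_neg]

/-- On the stack of θ and u the first component is L(θ - Au) + Lu, the form γ + η that
`unitSlopeMultiplier_quadratic` expects. -/
lemma blockDiag_mulVec_loopTransform {n p : ℕ} (A : Matrix (Fin n) (Fin n) ℝ)
    (L : Matrix (Fin p) (Fin n) ℝ) (s : Fin n ⊕ Fin n → ℂ) :
    Matrix.fromBlocks (toComplex L) 0 0 (toComplex L) *ᵥ (loopTransform A *ᵥ s)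
      = Sum.elim (toComplex (gradientBlock A L) *ᵥ s + toComplex (outputBlock L) *ᵥ s)
          (toComplex (outputBlock L) *ᵥ s) := by
  have hY : toComplex (outputBlock L) = Matrix.fromCols 0 (toComplex L) := by
    ext a (b | b) <;> simp [toComplex, outputBlock]
  have hG : toComplex (gradientBlock A L)
      = Matrix.fromCols (toComplex L) (-(toComplex L * toComplex A)) := by
    rw [← toComplex_mul]
    ext a (b | b) <;> simp [toComplex, gradientBlock]
  rw [hY, hG, loopTransform, Matrix.mulVec_mulVec, Matrix.fromBlocks_multiply,
    Matrix.fromBlocks_mulVec, Matrix.fromCols_mulVec, Matrix.fromCols_mulVec]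
  simp only [Matrix.mul_one, Matrix.zero_mul, Matrix.mul_zero, add_zero, zero_add,
    Matrix.mul_sub, Matrix.zero_mulVec, Matrix.sub_mulVec, Matrix.neg_mulVec]
  congr 1
  · abel
  · rw [sub_zero, zero_add]

/-- The quadratic form of the transformed parallel multiplier. -/
lemma loopMultiplier_quadratic {n N : ℕ} {ρ : Fin N → ℕ} (A : Matrix (Fin n) (Fin n) ℝ)
    (Lb : (i : Fin N) → Matrix (Fin (ρ i)) (Fin n) ℝ) (M : Fin N → RatFunc ℝ) (z : ℂ)
    (s : Fin n ⊕ Fin n → ℂ) :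
    star s ⬝ᵥ (loopMultiplier A Lb M z *ᵥ s)
      = ∑ i, ((∑ a, star ((toComplex (outputBlock (Lb i)) *ᵥ s) a)
          * (transferEval (M i) z * (toComplex (gradientBlock A (Lb i)) *ᵥ s) a))
        + star (∑ a, star ((toComplex (outputBlock (Lb i)) *ᵥ s) a)
          * (transferEval (M i) z * (toComplex (gradientBlock A (Lb i)) *ᵥ s) a))) := by
  have hpull : ∀ {κ : Type} [Fintype κ] (T : Matrix κ (Fin n ⊕ Fin n) ℂ) (U : Matrix κ κ ℂ)
      (q : Fin n ⊕ Fin n → ℂ), star q ⬝ᵥ ((Tᴴ * U * T) *ᵥ q) = star (T *ᵥ q) ⬝ᵥ (U *ᵥ (T *ᵥ q)) := by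
    intro κ _ T U q
    rw [Matrix.star_mulVec, ← Matrix.dotProduct_mulVec, Matrix.mulVec_mulVec,
      Matrix.mulVec_mulVec, Matrix.mul_assoc]
  have hD : ∀ i, (Matrix.fromBlocks (toComplex (Lb i)) 0 0 (toComplex (Lb i)))ᵀ
      = (Matrix.fromBlocks (toComplex (Lb i)) 0 0 (toComplex (Lb i)))ᴴ := by
    intro i
    rw [Matrix.fromBlocks_conjTranspose, Matrix.fromBlocks_transpose]
    simp [toComplex_conjTranspose]
  rw [loopMultiplier, ← conjTranspose_loopTransform, hpull, parallelMultiplier,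
    Matrix.sum_mulVec, dotProduct_sum]
  refine Finset.sum_congr rfl fun i _ => ?_
  rw [hD, hpull, blockDiag_mulVec_loopTransform, unitSlopeMultiplier_quadratic]

/-- The IQC with the transformed parallel multiplier. -/
theorem BarrierConstraints.admitsIQC_loopMultiplier {n N : ℕ} {C : BarrierConstraints n N}
    {H : Matrix (Fin n) (Fin n) ℝ} {μ m : ℝ} {M : Fin N → RatFunc ℝ}
    (horth : C.OrthogonalRows) (hμ : 0 < μ) (hB : C.HessianLowerBound m)
    (hH : H.PosSemidef) (hHt : (slopeMatrix H μ m).PosDef)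
    (hM : ∀ i, IsZamesFalbPlus (M i)) {ρ : Fin N → ℕ}
    {Lb : (i : Fin N) → Matrix (Fin (ρ i)) (Fin n) ℝ} (hLb : C.IsOrthonormalRowBasis Lb) :
    AdmitsIQC (C.mpcMap H μ) (loopMultiplier (slopeMatrix H μ m) Lb M) := by
  refine ⟨isIQCMultiplier_loopMultiplier _ _ hM, fun θ hθ => ?_⟩
  have hsol : ∀ t, C.IsMPCSolution H μ t (C.mpcMap H μ t) := fun t =>
    (isMPCSolution_iff hμ hB hH hHt t _).mpr rfl
  have hsol0 := isMPCSolution_zero hμ hB hHt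
  set φ := fun k => C.mpcMap H μ (θ k) with hφ
  have hφ2 : Memℓp φ 2 := by
    obtain ⟨l, hl, hcoer⟩ := hHt.exists_coercive
    refine memℓp_two_of_norm_le hθ l⁻¹ fun k => ?_
    simpa [div_eq_inv_mul] using (hsol (θ k)).norm_sub_le hμ hB hH hl hcoer hsol0
  refine ⟨hφ2, ?_⟩
  set A := slopeMatrix H μ m with hA
  let X : Fin N → ℝ → ℂ := fun i ω =>
    ∑ a, star (dtft (fun k => (outputBlock (Lb i) *ᵥ stack θ φ k) a) ω)
      * (transferEval (M i) (Complex.exp (ω * Complex.I))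
        * dtft (fun k => (gradientBlock A (Lb i) *ᵥ stack θ φ k) a) ω)
  have hX : ∀ i, IntervalIntegrable (X i) volume (-Real.pi) Real.pi ∧
      0 ≤ (∫ ω in (-Real.pi)..Real.pi, X i ω).re := by
    intro i
    have hsub : ∀ s t, C.groupPotential μ m Lb i (φ t)
        + (outputBlock (Lb i) *ᵥ stack θ φ s - outputBlock (Lb i) *ᵥ stack θ φ t) ⬝ᵥ
          (gradientBlock A (Lb i) *ᵥ stack θ φ t) ≤ C.groupPotential μ m Lb i (φ s) := by
      intro s t
      rw [outputBlock_mulVec_stack, outputBlock_mulVec_stack, gradientBlock_mulVec_stack]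
      exact (hsol (θ t)).groupPotential_le hμ hB hH hLb horth i (hsol (θ s)).1
    refine zamesFalb_integral_nonneg (V := fun t => C.groupPotential μ m Lb i (φ t)) (hM i)
      (memℓp_mulVec_stack hθ hφ2 _) (memℓp_mulVec_stack hθ hφ2 _) (fun t => ?_) (fun t => ?_) hsub
    -- Nonnegativity is the subgradient inequality based at the solution 0 for θ = 0, where the
    -- subgradient vanishes.
    · simpa [groupPotential_zero] using
        hsol0.groupPotential_le hμ hB hH hLb horth i (hsol (θ t)).1
    -- The upper bound by y·g is the subgradient inequality tested at v = 0.
    · have := (hsol (θ t)).groupPotential_le hμ hB hH hLb horth i C.zero_mem_domain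
      rw [groupPotential_zero, WithLp.ofLp_zero, Matrix.mulVec_zero, zero_sub,
        neg_dotProduct] at this
      rw [outputBlock_mulVec_stack, gradientBlock_mulVec_stack]
      linarith
  have hle : -Real.pi ≤ Real.pi := by linarith [Real.pi_pos]
  -- The transforms are L² classes, so they commute with constant matrices only almost everywhere.
  have hae : (fun ω => ∑ i, (X i ω + star (X i ω)))
      =ᵐ[volume.restrict (Set.uIoc (-Real.pi) Real.pi)]
        iqcIntegrand (loopMultiplier A Lb M) θ φ := by
    rw [Set.uIoc_of_le hle]
    have hY := ae_all_iff.mpr fun i => dtft_mulVec_stack_ae hθ hφ2 (outputBlock (Lb i))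
    have hG := ae_all_iff.mpr fun i => dtft_mulVec_stack_ae hθ hφ2 (gradientBlock A (Lb i))
    filter_upwards [hY, hG] with ω h1 h2
    rw [iqcIntegrand, loopMultiplier_quadratic]
    refine Finset.sum_congr rfl fun i _ => ?_
    have : X i ω = ∑ a, star ((toComplex (outputBlock (Lb i)) *ᵥ freqStack θ φ ω) a)
        * (transferEval (M i) (Complex.exp (ω * Complex.I))
          * (toComplex (gradientBlock A (Lb i)) *ᵥ freqStack θ φ ω) a) :=
      Finset.sum_congr rfl fun a _ => by rw [h1 i a, h2 i a]
    rw [this]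
  have hstar : ∀ i, IntervalIntegrable (fun ω => star (X i ω)) volume (-Real.pi) Real.pi := by
    intro i
    have h := (hX i).1
    rw [intervalIntegrable_iff] at h ⊢
    exact Complex.conjCLE.toContinuousLinearMap.integrable_comp h
  have hint : ∀ i ∈ (Finset.univ : Finset (Fin N)),
      IntervalIntegrable (fun ω => X i ω + star (X i ω)) volume (-Real.pi) Real.pi :=
    fun i _ => (hX i).1.add (hstar i)
  refine ⟨IntervalIntegrable.congr_ae ?_ hae, ?_⟩
  · simpa [Finset.sum_fn] using IntervalIntegrable.sum Finset.univ hint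
  · rw [← intervalIntegral.integral_congr_ae_restrict hae,
      intervalIntegral.integral_finsetSum hint, Complex.re_sum]
    refine Finset.sum_nonneg fun i _ => ?_
    rw [intervalIntegral.integral_add (hX i).1 (hstar i)]
    have hc : ∫ ω in (-Real.pi)..Real.pi, star (X i ω)
        = star (∫ ω in (-Real.pi)..Real.pi, X i ω) := intervalIntegral.intervalIntegral_conj
    rw [hc, Complex.add_re]
    exact add_nonneg (hX i).2 (hX i).2

end

/-! ### The main theorem. -/

theorem mainTheorem8 {n N : ℕ} (C : BarrierConstraints n N)
    (H : Matrix (Fin n) (Fin n) ℝ) (μ m : ℝ) (M : Fin N → RatFunc ℝ)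
    (hcompact : IsCompact C.feasible) (horth : C.OrthogonalRows)
    (hμ : 0 < μ) (hm : 0 ≤ m) (hB : C.HessianLowerBound m)
    (hH : H.PosSemidef) (hHt : (slopeMatrix H μ m).PosDef)
    (hM : ∀ i, IsZamesFalbPlus (M i)) :
    (∀ θ u, C.IsMPCSolution H μ θ u ↔ u = C.mpcMap H μ θ) ∧
    (∀ (ρ : Fin N → ℕ) (Lb : (i : Fin N) → Matrix (Fin (ρ i)) (Fin n) ℝ),
      C.IsOrthonormalRowBasis Lb →
        AdmitsIQC (C.mpcMap H μ) (fun z =>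
          (loopTransform (slopeMatrix H μ m))ᵀ * parallelMultiplier Lb M z
            * loopTransform (slopeMatrix H μ m))) ∧
    (∀ blk : Fin n → Fin N, C.BlockDiagonal blk →
      AdmitsIQC (C.mpcMap H μ) (stagedMultiplier (slopeMatrix H μ m) blk M) ∧
      ∀ (ρ : Fin N → ℕ) (Lb : (i : Fin N) → Matrix (Fin (ρ i)) (Fin n) ℝ),
        C.IsOrthonormalRowBasis Lb → ∀ z : ℂ,
          (loopTransform (slopeMatrix H μ m))ᵀ * parallelMultiplier Lb M z
            * loopTransform (slopeMatrix H μ m)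
            = stagedMultiplier (slopeMatrix H μ m) blk M z) := by
  have hloop := fun {ρ : Fin N → ℕ} {Lb : (i : Fin N) → Matrix (Fin (ρ i)) (Fin n) ℝ}
    (hLb : C.IsOrthonormalRowBasis Lb) =>
      C.admitsIQC_loopMultiplier horth hμ hB hH hHt hM hLb
  have hsymm : (slopeMatrix H μ m)ᵀ = slopeMatrix H μ m := by
    simpa [Matrix.IsHermitian] using hHt.isHermitian
  have hstaged : ∀ blk : Fin n → Fin N, C.BlockDiagonal blk → ∀ {ρ : Fin N → ℕ}
      {Lb : (i : Fin N) → Matrix (Fin (ρ i)) (Fin n) ℝ}, C.IsOrthonormalRowBasis Lb → ∀ z,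
        loopMultiplier (slopeMatrix H μ m) Lb M z = stagedMultiplier (slopeMatrix H μ m) blk M z :=
    fun blk hblk _ _ hLb z =>
      hLb.loopMultiplier_eq_stagedMultiplier horth hcompact hblk hsymm M z
  refine ⟨C.isMPCSolution_iff hμ hB hH hHt, fun ρ Lb hLb => hloop hLb, fun blk hblk =>
    ⟨?_, fun ρ Lb hLb => hstaged blk hblk hLb⟩⟩
  obtain ⟨ρ, Lb, hLb⟩ := C.exists_isOrthonormalRowBasis
  rw [← funext (hstaged blk hblk hLb)]
  exact hloop hLb
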